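/- Let $\sigma>0$, let $\Theta=[-1,1]^d$, and for $\theta\in\Theta$ let $X_1,\dots,X_n$ be i.i.d. with law $P_\theta=\mathcal N(\theta,\sigma^2 I_d)$ on $\mathbb R^d$, node $i$ holding $X_i$. The nodes communicate over a public blackboard in $T$ rounds: in round $t=1,\dots,T$ the nodes $i=1,\dots,n$ successively write a message $Y_{i,t}$, drawn through a channel with transition probability density $$p(y_{i,t}\mid x_i,\,y_{i-1,t},\dots,y_{1,t},\,\pi_{t-1},\dots,\pi_1)$$ with respect to a $\sigma$-finite measure on the (arbitrary) message space of $Y_{i,t}$, where $\pi_t=(y_{1,t},\dots,y_{n,t})$. The channels do not depend on $\theta$. Let $\Pi=(\Pi_1,\dots,\Pi_T)$, with $\Pi_t=(Y_{1,t},\dots,Y_{n,t})$, be the total transcript, so that, given $X_1=x_1,\dots,X_n=x_n$, it has the product of these densities over all $(i,t)$ as its density. Let $I_\theta(X_1,\dots,X_n;\Pi)\in[0,\infty]$ be the mutual information, in nats, between $(X_1,\dots,X_n)$ and $\Pi$ when the $X_i$ are drawn from $P_\theta$. Then every estimator $\hat\theta(\Pi)\in\mathbb R^d$, that is, every measurable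 function of the transcript, satisfies $$\sup_{\theta\in\Theta}\mathbb E_\theta\|\hat\theta(\Pi)-\theta\|_2^2\;\ge\;\frac{d^2}{\frac{2}{\sigma^2}\,\sup_{\theta\in\Theta} I_\theta(X_1,\dots,X_n;\Pi)+\pi^2 d},$$ where both sides take values in $[0,\infty]$, $\pi$ on the right-hand side is the number $3.14\ldots$, and the right-hand side is $0$ if the supremum of the mutual information is infinite or if $d=0$. -/

import Mathlib

open MeasureTheory ProbabilityTheory
open scoped ENNReal

/-- The Gaussian location model: `P_θ = N(θ, σ² I_d)` on `ℝ^d`. -/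
noncomputable def gaussianLocation {d : ℕ} (σ : ℝ) (θ : EuclideanSpace ℝ (Fin d)) :
    Measure (EuclideanSpace ℝ (Fin d)) :=
  multivariateGaussian θ (σ ^ 2 • (1 : Matrix (Fin d) (Fin d) ℝ))

/-- The parameter space `Θ = [-1, 1]^d`. -/
def paramCube (d : ℕ) : Set (EuclideanSpace ℝ (Fin d)) :=
  {θ | ∀ j, θ j ∈ Set.Icc (-1 : ℝ) 1}

/-- A slot `(t, i)` stands for the message of node `i` in round `t`. The slot `r` comes before the
slot `s` if its round is earlier, or if it is in the same round and its node has a smaller index. -/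
def Precedes {T n : ℕ} (r s : Fin T × Fin n) : Prop :=
  r.1 < s.1 ∨ (r.1 = s.1 ∧ r.2 < s.2)

/-- The part of the blackboard that has been written before slot `s`. -/
abbrev History {T n : ℕ} (𝒴 : Fin T × Fin n → Type*) (s : Fin T × Fin n) : Type _ :=
  ∀ r : {r : Fin T × Fin n // Precedes r s}, 𝒴 r.1

/-- The total blackboard transcript `Π`: all the messages of all the rounds. -/
abbrev Transcript {T n : ℕ} (𝒴 : Fin T × Fin n → Type*) : Type _ :=
  ∀ s : Fin T × Fin n, 𝒴 s

/-- The restriction of a full transcript to what was written before slot `s`. -/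
def Transcript.before {T n : ℕ} {𝒴 : Fin T × Fin n → Type*} (π : Transcript 𝒴)
    (s : Fin T × Fin n) : History 𝒴 s :=
  fun r => π r.1

/-- A public blackboard protocol with `n` nodes and `T` rounds: for each slot `s = (t, i)`, a channel
with transition probability density `p(y | x, h)` with respect to `ν s`, where `x` is the local
sample of node `i` and `h` is what the blackboard shows before slot `s`. -/
structure BlackboardProtocol {T n : ℕ} (𝒳 : Type*) [MeasurableSpace 𝒳]
    (𝒴 : Fin T × Fin n → Type*) [∀ s, MeasurableSpace (𝒴 s)] (ν : ∀ s, Measure (𝒴 s)) where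
  /-- the transition densities -/
  p : ∀ s : Fin T × Fin n, 𝒳 → History 𝒴 s → 𝒴 s → ℝ≥0∞
  measurable_p : ∀ s, Measurable fun z : 𝒳 × History 𝒴 s × 𝒴 s => p s z.1 z.2.1 z.2.2
  lintegral_p : ∀ s x h, ∫⁻ y, p s x h y ∂(ν s) = 1

namespace BlackboardProtocol

variable {T n : ℕ} {𝒳 : Type*} [MeasurableSpace 𝒳]
  {𝒴 : Fin T × Fin n → Type*} [∀ s, MeasurableSpace (𝒴 s)] {ν : ∀ s, Measure (𝒴 s)}

/-- The conditional density, with respect to the product of the measures `ν s`, of the transcript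
given the samples `x = (x_1, …, x_n)`: the product of the densities of the successive messages. -/
noncomputable def transcriptDensity (C : BlackboardProtocol 𝒳 𝒴 ν) (x : Fin n → 𝒳)
    (π : Transcript 𝒴) : ℝ≥0∞ :=
  ∏ s : Fin T × Fin n, C.p s (x s.2) (π.before s) (π s)

/-- The joint law of `((X_1, …, X_n), Π)` when `X_1, …, X_n` are i.i.d. with law `P`. -/
noncomputable def jointLaw (C : BlackboardProtocol 𝒳 𝒴 ν) (P : Measure 𝒳) :
    Measure ((Fin n → 𝒳) × Transcript 𝒴) :=
  ((Measure.pi fun _ : Fin n => P).prod (Measure.pi ν)).withDensity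
    fun z => C.transcriptDensity z.1 z.2

/-- The law of the transcript `Π` when `X_1, …, X_n` are i.i.d. with law `P`. -/
noncomputable def transcriptLaw (C : BlackboardProtocol 𝒳 𝒴 ν) (P : Measure 𝒳) :
    Measure (Transcript 𝒴) :=
  (C.jointLaw P).map Prod.snd

/-- The mutual information `I(X_1, …, X_n; Π)` (in nats) when `X_1, …, X_n` are i.i.d. with law `P`:
the Kullback-Leibler divergence of the joint law from the product of its marginals. -/
noncomputable def mutualInfo (C : BlackboardProtocol 𝒳 𝒴 ν) (P : Measure 𝒳) : ℝ≥0∞ :=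
  InformationTheory.klDiv (C.jointLaw P)
    (((C.jointLaw P).map Prod.fst).prod ((C.jointLaw P).map Prod.snd))

end BlackboardProtocol

-- This is a van Trees (Bayesian Cramér–Rao) argument in which the Fisher information carried by the
-- transcript is bounded by its mutual information with the samples.
--
-- Let `S_j(x) = (x_j - θ_j)/σ²` be the score of one sample. The transcript density is a product
-- over the nodes whose `i`-th factor involves only the sample `x_i`, so the samples stay
-- independent conditionally on `Π` (`posteriorMean_mul_of_ne`). Put `m_i = E[S(X_i) | Π]`. The
-- score of the transcript is `∑ i, m_i`, and since the scores are centred, the `m_i` are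
-- uncorrelated; the trace of the Fisher information is therefore `∑ i, E|m_i|²`. The
-- Donsker–Varadhan inequality with the test function `σ² ∑ m_i·S(x_i) - (σ²/2) ∑ |m_i|²` bounds
-- this by `(2/σ²) I`: the test function has mean `(σ²/2) ∑ E|m_i|²` under the joint law, and its
-- exponential has integral at most `1` under the product of the marginals, because `S` is Gaussian
-- with covariance `σ⁻² I_d` (`sum_integral_sq_samplePosteriorMean_le_klDiv`). No chain rule over
-- rounds or nodes is involved.
--
-- The prior is the product of the densities `cos²(πθ_j/2)`, which vanish at `±1` and have Fisher
-- information `π²`. Integration by parts shows that the error paired with the total score, prior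
-- score included, has Bayes mean `d`. Young's inequality with weight `l` then gives `d ≤ (l/2) R +
-- (dπ² + (2/σ²) I)/(2l)`, and a suitable `l` yields the bound. Transcript densities are never
-- differentiated: the joint law at `θ` is an exponential tilt of the one at `0`, so the integration
-- by parts takes place in `θ` with samples and transcript fixed. Truncating the estimator to the
-- cube makes everything integrable and does not increase the risk.

-- Product densities and the Donsker–Varadhan inequality.

section GeneralMeasureTheory

/-- The product of measures with real densities has the product density. -/
lemma pi_withDensity_ofReal {ι : Type*} [Fintype ι] {α : Type*}
    [MeasurableSpace α] (μ : ι → Measure α) [∀ i, SigmaFinite (μ i)]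
    (f : ι → α → ℝ) (hf0 : ∀ i x, 0 ≤ f i x) (hf : ∀ i, Integrable (f i) (μ i)) :
    Measure.pi (fun i => (μ i).withDensity fun x => ENNReal.ofReal (f i x)) =
      (Measure.pi μ).withDensity fun x => ENNReal.ofReal (∏ i, f i (x i)) := by
  have hfin : ∀ i, IsFiniteMeasure ((μ i).withDensity fun x => ENNReal.ofReal (f i x)) := fun i =>
    isFiniteMeasure_withDensity_ofReal (hf i).2
  apply Measure.pi_eq
  intro s hs
  have key : ∀ x : ι → α, (Set.univ.pi s).indicator (fun x => ENNReal.ofReal (∏ i, f i (x i))) x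
      = ENNReal.ofReal (∏ i, (s i).indicator (f i) (x i)) := by
    intro x
    by_cases hx : x ∈ Set.univ.pi s
    · rw [Set.indicator_of_mem hx]
      congr 1
      refine Finset.prod_congr rfl fun i _ => ?_
      rw [Set.indicator_of_mem (hx i (Set.mem_univ i))]
    · rw [Set.indicator_of_notMem hx]
      simp only [Set.mem_univ_pi, not_forall] at hx
      obtain ⟨i, hi⟩ := hx
      rw [Finset.prod_eq_zero (Finset.mem_univ i) (Set.indicator_of_notMem hi _),
        ENNReal.ofReal_zero]
  have hint : ∀ i, Integrable ((s i).indicator (f i)) (μ i) := fun i => (hf i).indicator (hs i)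
  have h0 : ∀ i x, 0 ≤ (s i).indicator (f i) x := fun i =>
    Set.indicator_nonneg fun x _ => hf0 i x
  rw [withDensity_apply _ (MeasurableSet.univ_pi hs),
    ← lintegral_indicator (MeasurableSet.univ_pi hs)]
  simp_rw [key]
  rw [← ofReal_integral_eq_lintegral_ofReal (Integrable.fintype_prod hint)
    (Filter.Eventually.of_forall fun x => Finset.prod_nonneg fun i _ => h0 i _),
    integral_fintype_prod_eq_prod,
    ENNReal.ofReal_prod_of_nonneg fun i _ => integral_nonneg (h0 i)]
  refine Finset.prod_congr rfl fun i _ => ?_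
  rw [withDensity_apply _ (hs i), integral_indicator (hs i),
    ofReal_integral_eq_lintegral_ofReal (hf i).integrableOn
      (Filter.Eventually.of_forall fun x => hf0 i x)]

/-- Fenchel–Young: `exp t - 1` is the convex conjugate of `r log r + 1 - r`. For `r > 0` it is `1 +
x ≤ exp x` at `x = t - log r`, multiplied by `r`. -/
lemma mul_le_klFun_add_exp {r : ℝ} (hr : 0 ≤ r) (t : ℝ) :
    r * t ≤ InformationTheory.klFun r + (Real.exp t - 1) := by
  rw [InformationTheory.klFun_apply]
  rcases hr.eq_or_lt with rfl | hr
  · simpa using (Real.exp_pos t).le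
  · have h := mul_le_mul_of_nonneg_left (Real.add_one_le_exp (t - Real.log r)) hr.le
    rw [Real.exp_sub, Real.exp_log hr, mul_div_cancel₀ _ hr.ne'] at h
    linarith

/-- One half of the Donsker-Varadhan variational formula. -/
lemma ofReal_integral_le_klDiv {α : Type*} [MeasurableSpace α] {J M : Measure α}
    [IsProbabilityMeasure J] [IsProbabilityMeasure M] {F : α → ℝ} (hFm : Measurable F)
    (hF : Integrable F J) (hexp : ∫⁻ x, ENNReal.ofReal (Real.exp (F x)) ∂M ≤ 1) :
    ENNReal.ofReal (∫ x, F x ∂J) ≤ InformationTheory.klDiv J M := by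
  by_cases htop : InformationTheory.klDiv J M = ∞
  · simp [htop]
  obtain ⟨hac, hllr⟩ := InformationTheory.klDiv_ne_top_iff.1 htop
  rw [ENNReal.ofReal_le_iff_le_toReal htop,
    InformationTheory.toReal_klDiv_eq_integral_klFun hac, ← integral_rnDeriv_smul hac]
  have hexpi : Integrable (fun x => Real.exp (F x)) M := by
    refine ⟨hFm.exp.aestronglyMeasurable, ?_⟩
    rw [hasFiniteIntegral_iff_ofReal (Filter.Eventually.of_forall fun x => (Real.exp_pos _).le)]
    exact hexp.trans_lt ENNReal.one_lt_top
  have hexp1 : ∫ x, Real.exp (F x) ∂M ≤ 1 := by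
    rw [integral_eq_lintegral_of_nonneg_ae
      (Filter.Eventually.of_forall fun x => (Real.exp_pos _).le) hFm.exp.aestronglyMeasurable]
    exact ENNReal.toReal_le_of_le_ofReal zero_le_one (by simpa using hexp)
  have hkl := (InformationTheory.integrable_klFun_rnDeriv_iff hac).2 hllr
  have hexpi' : Integrable (fun x => Real.exp (F x) - 1) M := hexpi.sub (integrable_const 1)
  calc ∫ x, (J.rnDeriv M x).toReal • F x ∂M
      ≤ ∫ x, (InformationTheory.klFun (J.rnDeriv M x).toReal + (Real.exp (F x) - 1)) ∂M := by
        refine integral_mono ((integrable_rnDeriv_smul_iff hac).2 hF) (hkl.add hexpi') fun x => ?_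
        exact mul_le_klFun_add_exp ENNReal.toReal_nonneg _
    _ ≤ _ := by
        rw [integral_add hkl hexpi', integral_sub hexpi (integrable_const 1)]
        simp only [integral_const, probReal_univ, smul_eq_mul, mul_one]
        linarith

end GeneralMeasureTheory

-- The transcript density: normalization and factorization over nodes.

namespace BlackboardProtocol

variable {T n : ℕ} {𝒳 : Type*} [MeasurableSpace 𝒳]
  {𝒴 : Fin T × Fin n → Type*} [∀ s, MeasurableSpace (𝒴 s)] {ν : ∀ s, Measure (𝒴 s)}

lemma measurable_before (s : Fin T × Fin n) :
    Measurable fun π : Transcript 𝒴 => π.before s :=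
  measurable_pi_lambda _ fun r => measurable_pi_apply r.1

lemma measurable_message_density (C : BlackboardProtocol 𝒳 𝒴 ν) (s : Fin T × Fin n) :
    Measurable fun z : 𝒳 × Transcript 𝒴 => C.p s z.1 (z.2.before s) (z.2 s) :=
  (C.measurable_p s).comp (measurable_fst.prodMk
    (((measurable_before s).comp measurable_snd).prodMk
      ((measurable_pi_apply s).comp measurable_snd)))

-- Messages are integrated out in reverse order of writing. The lexicographically last slot of `D`
-- lies in the history of no slot of `D`, so its variable occurs in its own factor only, which
-- integrates to `1`. Slots outside `D` are merely frozen, so `D` need not be an initial segment.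
open Classical in
lemma lmarginal_prod_density [∀ s, SigmaFinite (ν s)] (C : BlackboardProtocol 𝒳 𝒴 ν)
    (x : Fin n → 𝒳) (D : Finset (Fin T × Fin n)) :
    lmarginal ν D (fun π : Transcript 𝒴 => ∏ s ∈ D, C.p s (x s.2) (π.before s) (π s)) = 1 := by
  have hm : ∀ s, Measurable fun π : Transcript 𝒴 => C.p s (x s.2) (π.before s) (π s) := fun s =>
    (C.measurable_message_density s).comp measurable_prodMk_left
  induction D using Finset.induction_on_max_value (toLex : Fin T × Fin n → Fin T ×ₗ Fin n) with
  | empty => ext; simp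
  | insert a D ha hmax ih =>
    rw [lmarginal_insert' _ (Finset.measurable_fun_prod _ fun s _ => hm s) ha, ← ih]
    congr 1
    ext π
    have hprec : ∀ s ∈ insert a D, ¬ Precedes a s := by
      intro s hs hp
      have hlt : toLex a < toLex s := Prod.Lex.toLex_lt_toLex.2 hp
      rcases Finset.mem_insert.1 hs with rfl | hs
      · exact lt_irrefl _ hlt
      · exact absurd (hmax s hs) (not_le.2 hlt)
    have hbefore : ∀ s ∈ insert a D, ∀ y : 𝒴 a,
        Transcript.before (𝒴 := 𝒴) (Function.update π a y) s = Transcript.before (𝒴 := 𝒴) π s := by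
      intro s hs y
      ext r
      have : r.1 ≠ a := fun h => hprec s hs (h ▸ r.2)
      simp [Transcript.before, Function.update_of_ne this]
    have hprod : ∀ y : 𝒴 a, ∏ s ∈ insert a D, C.p s (x s.2)
          (Transcript.before (𝒴 := 𝒴) (Function.update π a y) s) (Function.update π a y s)
        = C.p a (x a.2) (Transcript.before (𝒴 := 𝒴) π a) y *
            ∏ s ∈ D, C.p s (x s.2) (Transcript.before (𝒴 := 𝒴) π s) (π s) := by
      intro y
      rw [Finset.prod_insert ha, hbefore a (Finset.mem_insert_self a D), Function.update_self]
      congr 1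
      refine Finset.prod_congr rfl fun s hs => ?_
      rw [hbefore s (Finset.mem_insert_of_mem hs),
        Function.update_of_ne (ne_of_mem_of_not_mem hs ha)]
    simp_rw [hprod]
    have hma : Measurable fun y => C.p a (x a.2) (Transcript.before (𝒴 := 𝒴) π a) y :=
      (C.measurable_p a).comp (measurable_const.prodMk (measurable_const.prodMk measurable_id))
    rw [lintegral_mul_const _ hma, C.lintegral_p, one_mul]

/-- A density with integral `1` cannot live on an empty space; but a density exists only once a
history is given, hence the induction along the writing order. The transcript obtained serves as the
base point for `lmarginal`. -/
lemma nonempty_transcript (C : BlackboardProtocol 𝒳 𝒴 ν) (x : Fin n → 𝒳) :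
    Nonempty (Transcript 𝒴) := by
  have hwf : WellFounded fun r s : Fin T × Fin n => toLex r < toLex s :=
    InvImage.wf toLex (wellFounded_lt (α := Fin T ×ₗ Fin n))
  suffices h : ∀ s, Nonempty (𝒴 s) from ⟨fun s => (h s).some⟩
  intro s
  induction s using hwf.induction with
  | _ s ih =>
    by_contra hs
    rw [not_nonempty_iff] at hs
    have h := C.lintegral_p s (x s.2) fun r => (ih r.1 (Prod.Lex.toLex_lt_toLex.2 r.2)).some
    rw [Measure.eq_zero_of_isEmpty (ν s), lintegral_zero_measure] at h
    exact zero_ne_one h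

/-- The transcript density is a probability density for every value of the samples. -/
lemma lintegral_transcriptDensity [∀ s, SigmaFinite (ν s)] (C : BlackboardProtocol 𝒳 𝒴 ν)
    (x : Fin n → 𝒳) : ∫⁻ π, C.transcriptDensity x π ∂(Measure.pi ν) = 1 := by
  classical
  obtain ⟨π₀⟩ := C.nonempty_transcript x
  rw [lintegral_eq_lmarginal_univ π₀]
  exact congrFun (C.lmarginal_prod_density x Finset.univ) π₀

/-- The density of the part of the transcript that is written by node `i`. -/
noncomputable def nodeDensity (C : BlackboardProtocol 𝒳 𝒴 ν) (i : Fin n) (x : 𝒳)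
    (π : Transcript 𝒴) : ℝ≥0∞ :=
  ∏ t : Fin T, C.p (t, i) x (π.before (t, i)) (π (t, i))

lemma measurable_nodeDensity (C : BlackboardProtocol 𝒳 𝒴 ν) (i : Fin n) :
    Measurable fun z : 𝒳 × Transcript 𝒴 => C.nodeDensity i z.1 z.2 :=
  Finset.measurable_fun_prod _ fun t _ => C.measurable_message_density (t, i)

/-- Regrouping the messages by author gives, for a fixed transcript, a product of functions of the
separate samples. This and the normalization are all that is used about the protocol afterwards. -/
lemma transcriptDensity_eq_prod_nodeDensity (C : BlackboardProtocol 𝒳 𝒴 ν) (x : Fin n → 𝒳)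
    (π : Transcript 𝒴) :
    C.transcriptDensity x π = ∏ i, C.nodeDensity i (x i) π := by
  simp only [transcriptDensity, nodeDensity, Fintype.prod_prod_type_right]

end BlackboardProtocol

-- Posterior means and Bayes' formula for a channel with a density.

section Posterior

variable {X Y : Type*} [MeasurableSpace X] [MeasurableSpace Y]

/-- The posterior mean of `g` given `y`, for the prior `μ` and the likelihood `D`. -/
noncomputable def posteriorMean (μ : Measure X) (D : X × Y → ℝ≥0∞) (g : X → ℝ) (y : Y) : ℝ :=
  (∫ x, (D (x, y)).toReal * g x ∂μ) / ∫ x, (D (x, y)).toReal ∂μ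

variable {μ : Measure X} {ν : Measure Y} [SigmaFinite ν] {D : X × Y → ℝ≥0∞}

lemma map_fst_withDensity_channel [SFinite μ] (hD : Measurable D)
    (hD1 : ∀ x, ∫⁻ y, D (x, y) ∂ν = 1) :
    ((μ.prod ν).withDensity D).map Prod.fst = μ := by
  ext s hs
  rw [Measure.map_apply measurable_fst hs, withDensity_apply _ (measurable_fst hs),
    ← lintegral_indicator (measurable_fst hs),
    lintegral_prod _ (hD.indicator (measurable_fst hs)).aemeasurable]
  have : ∀ x, ∫⁻ y, (Prod.fst ⁻¹' s).indicator D (x, y) ∂ν = s.indicator 1 x := by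
    intro x
    by_cases hx : x ∈ s
    · simp [Set.indicator, hx, hD1]
    · simp [Set.indicator, hx]
  simp_rw [this]
  rw [lintegral_indicator_one hs]

variable [IsProbabilityMeasure μ]

lemma isProbabilityMeasure_withDensity_channel (hD : Measurable D)
    (hD1 : ∀ x, ∫⁻ y, D (x, y) ∂ν = 1) :
    IsProbabilityMeasure ((μ.prod ν).withDensity D) := by
  refine ⟨?_⟩
  rw [withDensity_apply _ MeasurableSet.univ, Measure.restrict_univ,
    lintegral_prod _ hD.aemeasurable]
  simp [hD1]

lemma ae_lt_top_channel (hD : Measurable D) (hD1 : ∀ x, ∫⁻ y, D (x, y) ∂ν = 1) :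
    ∀ᵐ z ∂(μ.prod ν), D z < ∞ := by
  refine ae_lt_top hD ?_
  rw [lintegral_prod _ hD.aemeasurable]
  simp [hD1]

lemma integrable_toReal_channel (hD : Measurable D) (hD1 : ∀ x, ∫⁻ y, D (x, y) ∂ν = 1) :
    Integrable (fun z => (D z).toReal) (μ.prod ν) := by
  refine integrable_toReal_of_lintegral_ne_top hD.aemeasurable ?_
  rw [lintegral_prod _ hD.aemeasurable]
  simp [hD1]

lemma measurable_posteriorMean (hD : Measurable D) {g : X → ℝ} (hg : Measurable g) :
    Measurable (posteriorMean μ D g) := by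
  refine Measurable.div ?_ ?_
  · exact (((hD.ennreal_toReal.mul (hg.comp measurable_fst)).stronglyMeasurable).integral_prod_left'
      (μ := μ)).measurable
  · exact ((hD.ennreal_toReal.stronglyMeasurable).integral_prod_left' (μ := μ)).measurable

lemma measurePreserving_fst_channel (hD : Measurable D) (hD1 : ∀ x, ∫⁻ y, D (x, y) ∂ν = 1) :
    MeasurePreserving Prod.fst ((μ.prod ν).withDensity D) μ :=
  ⟨measurable_fst, map_fst_withDensity_channel hD hD1⟩

/-- Bayes' formula: the conditional expectation given the output of the channel is the posterior
mean. -/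
lemma posteriorMean_ae_eq_condExp (hD : Measurable D) (hD1 : ∀ x, ∫⁻ y, D (x, y) ∂ν = 1)
    {g : X → ℝ} (hg : Measurable g) (hgi : Integrable g μ) :
    (fun z : X × Y => posteriorMean μ D g z.2) =ᵐ[(μ.prod ν).withDensity D]
      ((μ.prod ν).withDensity D)[fun z => g z.1 |
        MeasurableSpace.comap (Prod.snd : X × Y → Y) inferInstance] := by
  have hprob := isProbabilityMeasure_withDensity_channel (μ := μ) hD hD1
  have hlt := ae_lt_top_channel (μ := μ) hD hD1
  have hr := integrable_toReal_channel (μ := μ) hD hD1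
  have hgJ : Integrable (fun z : X × Y => g z.1) ((μ.prod ν).withDensity D) :=
    (measurePreserving_fst_channel hD hD1).integrable_comp_of_integrable hgi
  have hrg : Integrable (fun z : X × Y => (D z).toReal * g z.1) (μ.prod ν) :=
    (integrable_withDensity_iff_integrable_smul' hD hlt).1 hgJ
  have hpm : Measurable (posteriorMean μ D g) := measurable_posteriorMean hD hg
  -- The cross-multiplied form survives a vanishing normalizer: the likelihood is then zero for
  -- almost every `x`, and both sides are `0`.
  have key : ∀ᵐ y ∂ν, (∫ x, (D (x, y)).toReal ∂μ) * posteriorMean μ D g y =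
      ∫ x, (D (x, y)).toReal * g x ∂μ := by
    filter_upwards [hr.prod_left_ae] with y hy
    by_cases h0 : ∫ x, (D (x, y)).toReal ∂μ = 0
    · rw [h0, zero_mul, eq_comm]
      have := (integral_eq_zero_iff_of_nonneg (fun x => ENNReal.toReal_nonneg) hy).1 h0
      refine integral_eq_zero_of_ae ?_
      filter_upwards [this] with x hx
      simp only [Pi.zero_apply] at hx ⊢
      rw [hx, zero_mul]
    · rw [posteriorMean, mul_div_cancel₀ _ h0]
  -- Integrating the absolute value over `x` first leaves the absolute value of `∫ D g`, by `key`;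
  -- this is integrable in `y` as a marginal of `hrg`.
  have hrp : Integrable (fun z : X × Y => (D z).toReal * posteriorMean μ D g z.2) (μ.prod ν) := by
    refine (integrable_prod_iff' ?_).2 ⟨?_, ?_⟩
    · exact (hD.ennreal_toReal.mul (hpm.comp measurable_snd)).aestronglyMeasurable
    · filter_upwards [hr.prod_left_ae] with y hy using hy.mul_const _
    · refine hrg.integral_prod_right.norm.congr ?_
      filter_upwards [key] with y hy
      simp only [norm_mul, Real.norm_eq_abs, ENNReal.abs_toReal]
      rw [integral_mul_const, ← hy, abs_mul,
        abs_of_nonneg (integral_nonneg fun x => ENNReal.toReal_nonneg)]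
  have hpJ : Integrable (fun z : X × Y => posteriorMean μ D g z.2) ((μ.prod ν).withDensity D) :=
    (integrable_withDensity_iff_integrable_smul' hD hlt).2 hrp
  refine ae_eq_condExp_of_forall_setIntegral_eq measurable_snd.comap_le hgJ
    (fun s _ _ => hpJ.integrableOn) ?_ ?_
  · rintro _ ⟨t, ht, rfl⟩ -
    rw [← integral_indicator (measurable_snd ht), ← integral_indicator (measurable_snd ht),
      integral_withDensity_eq_integral_toReal_smul hD hlt,
      integral_withDensity_eq_integral_toReal_smul hD hlt]
    have e : ∀ (φ : X × Y → ℝ) (z : X × Y),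
        (D z).toReal • (Prod.snd ⁻¹' t).indicator φ z =
          t.indicator 1 z.2 * ((D z).toReal * φ z) := by
      intro φ z
      by_cases hz : z.2 ∈ t
      · simp [Set.indicator, hz]
      · simp [Set.indicator, hz]
    have hind : ∀ (φ : X × Y → ℝ), Integrable φ (μ.prod ν) →
        Integrable (fun z => t.indicator (1 : Y → ℝ) z.2 * φ z) (μ.prod ν) := by
      intro φ hφ
      refine (hφ.indicator (measurable_snd ht)).congr (Filter.Eventually.of_forall fun z => ?_)
      by_cases hz : z.2 ∈ t
      · simp [Set.indicator, hz]
      · simp [Set.indicator, hz]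
    simp_rw [e]
    rw [integral_prod_symm _ (hind _ hrp), integral_prod_symm _ (hind _ hrg)]
    refine integral_congr_ae ?_
    filter_upwards [key] with y hy
    rw [integral_const_mul, integral_const_mul, integral_mul_const, hy]
  · exact (hpm.comp (comap_measurable _)).aestronglyMeasurable

lemma memLp_posteriorMean (hD : Measurable D) (hD1 : ∀ x, ∫⁻ y, D (x, y) ∂ν = 1)
    {g : X → ℝ} (hg : Measurable g) (hgi : MemLp g 2 μ) :
    MemLp (fun z : X × Y => posteriorMean μ D g z.2) 2 ((μ.prod ν).withDensity D) := by
  have hprob := isProbabilityMeasure_withDensity_channel (μ := μ) hD hD1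
  refine MemLp.ae_eq (posteriorMean_ae_eq_condExp hD hD1 hg (hgi.integrable one_le_two)).symm ?_
  exact (hgi.comp_measurePreserving (measurePreserving_fst_channel hD hD1)).condExp one_le_two

lemma integral_posteriorMean (hD : Measurable D) (hD1 : ∀ x, ∫⁻ y, D (x, y) ∂ν = 1)
    {g : X → ℝ} (hg : Measurable g) (hgi : Integrable g μ) :
    ∫ z, posteriorMean μ D g z.2 ∂((μ.prod ν).withDensity D) = ∫ x, g x ∂μ := by
  have hprob := isProbabilityMeasure_withDensity_channel (μ := μ) hD hD1
  rw [integral_congr_ae (posteriorMean_ae_eq_condExp hD hD1 hg hgi),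
    integral_condExp measurable_snd.comap_le]
  have hmp := measurePreserving_fst_channel (μ := μ) hD hD1
  conv_rhs => rw [← hmp.map_eq]
  rw [integral_map measurable_fst.aemeasurable hg.aestronglyMeasurable]

lemma integral_mul_posteriorMean (hD : Measurable D) (hD1 : ∀ x, ∫⁻ y, D (x, y) ∂ν = 1)
    {g : X → ℝ} (hg : Measurable g) (hgi : MemLp g 2 μ) {h : Y → ℝ} (hh : Measurable h)
    (hhi : MemLp (fun z : X × Y => h z.2) 2 ((μ.prod ν).withDensity D)) :
    ∫ z, h z.2 * g z.1 ∂((μ.prod ν).withDensity D) =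
      ∫ z, h z.2 * posteriorMean μ D g z.2 ∂((μ.prod ν).withDensity D) := by
  have hprob := isProbabilityMeasure_withDensity_channel (μ := μ) hD hD1
  have hgJ := hgi.comp_measurePreserving (measurePreserving_fst_channel (ν := ν) hD hD1)
  have hce := condExp_mul_of_stronglyMeasurable_left
    (m := MeasurableSpace.comap (Prod.snd : X × Y → Y) inferInstance)
    (f := fun z : X × Y => h z.2) (g := fun z => g z.1)
    (hh.comp (comap_measurable _)).stronglyMeasurable (hhi.integrable_mul hgJ)
    (hgJ.integrable one_le_two)
  rw [← integral_condExp measurable_snd.comap_le]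
  refine integral_congr_ae ?_
  filter_upwards [hce, posteriorMean_ae_eq_condExp hD hD1 hg (hgi.integrable one_le_two)]
    with z h1 h2
  rw [h2]
  exact h1

end Posterior

-- Conditional independence of the samples under a product likelihood.

section ProductPosterior

variable {𝒳 Y : Type*} [MeasurableSpace 𝒳] {n : ℕ}

/-- The likelihood of independent samples when it is a product over the samples. -/
noncomputable def productLikelihood (q : Fin n → 𝒳 → Y → ℝ≥0∞) (z : (Fin n → 𝒳) × Y) : ℝ≥0∞ :=
  ∏ i, q i (z.1 i) z.2

lemma measurable_productLikelihood [MeasurableSpace Y] {q : Fin n → 𝒳 → Y → ℝ≥0∞}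
    (hq : ∀ i, Measurable fun z : 𝒳 × Y => q i z.1 z.2) : Measurable (productLikelihood q) :=
  Finset.measurable_fun_prod _ fun i _ =>
    (hq i).comp (f := fun z : (Fin n → 𝒳) × Y => (z.1 i, z.2))
      (((measurable_pi_apply i).comp measurable_fst).prodMk measurable_snd)

variable (P : Measure 𝒳) [IsProbabilityMeasure P]

/-- Under a product likelihood, independent samples stay independent under the posterior. -/
lemma posteriorMean_mul_of_ne (q : Fin n → 𝒳 → Y → ℝ≥0∞) (g g' : 𝒳 → ℝ) {i k : Fin n}
    (hik : i ≠ k) (y : Y) :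
    posteriorMean (Measure.pi fun _ : Fin n => P) (productLikelihood q)
        (fun x => g (x i) * g' (x k)) y =
      posteriorMean (Measure.pi fun _ : Fin n => P) (productLikelihood q) (fun x => g (x i)) y *
        posteriorMean (Measure.pi fun _ : Fin n => P) (productLikelihood q)
          (fun x => g' (x k)) y := by
  classical
  set a : Fin n → ℝ := fun l => ∫ x, (q l x y).toReal ∂P
  have h0 : ∫ x, (productLikelihood q (x, y)).toReal ∂(Measure.pi fun _ : Fin n => P) =
      ∏ l, a l := by
    simp only [productLikelihood, ENNReal.toReal_prod]
    exact integral_fintype_prod_eq_prod fun l x => (q l x y).toReal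
  have h1 : ∀ (φ : 𝒳 → ℝ) (j : Fin n),
      ∫ x, (productLikelihood q (x, y)).toReal * φ (x j) ∂(Measure.pi fun _ : Fin n => P) =
        ∏ l, if l = j then ∫ x, (q l x y).toReal * φ x ∂P else a l := by
    intro φ j
    have := integral_fintype_prod_eq_prod (μ := fun _ : Fin n => P)
      (fun l x => (q l x y).toReal * if l = j then φ x else 1)
    simp only [Finset.prod_mul_distrib, Finset.prod_ite_eq', Finset.mem_univ, if_true] at this
    simp only [productLikelihood, ENNReal.toReal_prod]
    rw [this]
    refine Finset.prod_congr rfl fun l _ => ?_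
    split_ifs <;> simp [a]
  have h2 : ∫ x, (productLikelihood q (x, y)).toReal * (g (x i) * g' (x k))
        ∂(Measure.pi fun _ : Fin n => P) =
      ∏ l, if l = i then ∫ x, (q l x y).toReal * g x ∂P else
        if l = k then ∫ x, (q l x y).toReal * g' x ∂P else a l := by
    have := integral_fintype_prod_eq_prod (μ := fun _ : Fin n => P)
      (fun l x => (q l x y).toReal * ((if l = i then g x else 1) * if l = k then g' x else 1))
    simp only [Finset.prod_mul_distrib, Finset.prod_ite_eq', Finset.mem_univ, if_true] at this
    simp only [productLikelihood, ENNReal.toReal_prod]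
    rw [this]
    refine Finset.prod_congr rfl fun l _ => ?_
    by_cases hi : l = i
    · have hk : l ≠ k := hi ▸ hik
      simp [hi, hik]
    · simp only [hi, if_false, one_mul]
      split_ifs <;> simp [a]
  simp only [posteriorMean, h0, h1, h2]
  -- With a zero normalizer both sides are `0`, since division by zero gives `0`. Otherwise the
  -- cross-multiplied identity holds factor by factor.
  by_cases hz : ∏ l, a l = 0
  · simp [hz]
  rw [div_mul_div_comm, div_eq_div_iff hz (mul_ne_zero hz hz), ← Finset.prod_mul_distrib,
    ← Finset.prod_mul_distrib, ← Finset.prod_mul_distrib, ← Finset.prod_mul_distrib]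
  refine Finset.prod_congr rfl fun l _ => ?_
  by_cases hi : l = i
  · have hk : l ≠ k := hi ▸ hik
    simp only [hi, hik, if_true, if_false]
    ring
  · simp only [hi, if_false]
    split_ifs <;> ring

lemma integral_pi_mul_of_ne (g g' : 𝒳 → ℝ) {i k : Fin n} (hik : i ≠ k) (hg : ∫ x, g x ∂P = 0) :
    ∫ x, g (x i) * g' (x k) ∂(Measure.pi fun _ : Fin n => P) = 0 := by
  classical
  have := integral_fintype_prod_eq_prod (μ := fun _ : Fin n => P)
    (fun l x => ((if l = i then g x else 1) * if l = k then g' x else 1))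
  simp only [Finset.prod_mul_distrib, Finset.prod_ite_eq', Finset.mem_univ, if_true] at this
  rw [this]
  refine Finset.prod_eq_zero (Finset.mem_univ i) ?_
  simp [hik, hg]

end ProductPosterior

-- Posterior means of sub-Gaussian scores and mutual information.

section ScoreBound

/-- The joint law of `n` independent samples of law `P` and of the output of the channel with
likelihood `∏ i, q i (x i) y` with respect to `ν`. -/
noncomputable def productChannelLaw {𝒳 Y : Type*} [MeasurableSpace 𝒳] [MeasurableSpace Y] {n : ℕ}
    (P : Measure 𝒳) (ν : Measure Y) (q : Fin n → 𝒳 → Y → ℝ≥0∞) : Measure ((Fin n → 𝒳) × Y) :=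
  ((Measure.pi fun _ : Fin n => P).prod ν).withDensity (productLikelihood q)

/-- The posterior mean of `g (x i)` given the output of the channel. -/
noncomputable def samplePosteriorMean {𝒳 Y : Type*} [MeasurableSpace 𝒳] {n : ℕ}
    (P : Measure 𝒳) (q : Fin n → 𝒳 → Y → ℝ≥0∞) (i : Fin n) (g : 𝒳 → ℝ) (y : Y) : ℝ :=
  posteriorMean (Measure.pi fun _ : Fin n => P) (productLikelihood q) (fun x => g (x i)) y

variable {𝒳 Y : Type*} [MeasurableSpace 𝒳] [MeasurableSpace Y] {n : ℕ}
  {P : Measure 𝒳} [IsProbabilityMeasure P] {ν : Measure Y} [SigmaFinite ν]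
  {q : Fin n → 𝒳 → Y → ℝ≥0∞}

lemma measurable_samplePosteriorMean (hq : ∀ i, Measurable fun z : 𝒳 × Y => q i z.1 z.2)
    {g : 𝒳 → ℝ} (hg : Measurable g) (i : Fin n) : Measurable (samplePosteriorMean P q i g) :=
  measurable_posteriorMean (measurable_productLikelihood hq) (hg.comp (measurable_pi_apply i))

lemma memLp_eval {g : 𝒳 → ℝ} (hgi : MemLp g 2 P) (i : Fin n) :
    MemLp (fun x : Fin n → 𝒳 => g (x i)) 2 (Measure.pi fun _ : Fin n => P) :=
  hgi.comp_measurePreserving (measurePreserving_eval (fun _ : Fin n => P) i)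

lemma integral_pi_eval {g : 𝒳 → ℝ} (hg : Measurable g) (i : Fin n) :
    ∫ x, g (x i) ∂(Measure.pi fun _ : Fin n => P) = ∫ x, g x ∂P := by
  have h := (measurePreserving_eval (fun _ : Fin n => P) i).map_eq
  conv_rhs => rw [← h]
  rw [integral_map (measurable_pi_apply i).aemeasurable hg.aestronglyMeasurable]

section

variable (hq : ∀ i, Measurable fun z : 𝒳 × Y => q i z.1 z.2)
  (hq1 : ∀ x, ∫⁻ y, productLikelihood q (x, y) ∂ν = 1)

include hq hq1

lemma isProbabilityMeasure_productChannelLaw : IsProbabilityMeasure (productChannelLaw P ν q) :=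
  isProbabilityMeasure_withDensity_channel (measurable_productLikelihood hq) hq1

lemma measurePreserving_fst_productChannelLaw :
    MeasurePreserving Prod.fst (productChannelLaw P ν q) (Measure.pi fun _ : Fin n => P) :=
  measurePreserving_fst_channel (measurable_productLikelihood hq) hq1

lemma memLp_sample {g : 𝒳 → ℝ} (hgi : MemLp g 2 P) (i : Fin n) :
    MemLp (fun z => g (z.1 i)) 2 (productChannelLaw P ν q) :=
  (memLp_eval hgi i).comp_measurePreserving (measurePreserving_fst_productChannelLaw hq hq1)

lemma memLp_samplePosteriorMean {g : 𝒳 → ℝ} (hg : Measurable g) (hgi : MemLp g 2 P) (i : Fin n) :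
    MemLp (fun z => samplePosteriorMean P q i g z.2) 2 (productChannelLaw P ν q) :=
  memLp_posteriorMean (measurable_productLikelihood hq) hq1 (hg.comp (measurable_pi_apply i))
    (memLp_eval hgi i)

lemma integral_mul_sample {g : 𝒳 → ℝ} (hg : Measurable g) (hgi : MemLp g 2 P) (i : Fin n)
    {h : Y → ℝ} (hh : Measurable h)
    (hhi : MemLp (fun z : (Fin n → 𝒳) × Y => h z.2) 2 (productChannelLaw P ν q)) :
    ∫ z, h z.2 * g (z.1 i) ∂(productChannelLaw P ν q) =
      ∫ z, h z.2 * samplePosteriorMean P q i g z.2 ∂(productChannelLaw P ν q) :=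
  integral_mul_posteriorMean (measurable_productLikelihood hq) hq1
    (hg.comp (measurable_pi_apply i)) (memLp_eval hgi i) hh hhi

lemma integral_samplePosteriorMean {g : 𝒳 → ℝ} (hg : Measurable g) (hgi : MemLp g 2 P)
    (i : Fin n) :
    ∫ z, samplePosteriorMean P q i g z.2 ∂(productChannelLaw P ν q) = ∫ x, g x ∂P := by
  rw [← integral_pi_eval (n := n) hg i]
  exact integral_posteriorMean (measurable_productLikelihood hq) hq1
    (hg.comp (measurable_pi_apply i)) ((memLp_eval hgi i).integrable one_le_two)

/-- The posterior means of centred functions of different samples are uncorrelated. -/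
lemma integral_samplePosteriorMean_mul_of_ne {g : 𝒳 → ℝ} (hg : Measurable g) (hgi : MemLp g 2 P)
    (hg0 : ∫ x, g x ∂P = 0) {i k : Fin n} (hik : i ≠ k) :
    ∫ z, samplePosteriorMean P q i g z.2 * samplePosteriorMean P q k g z.2
      ∂(productChannelLaw P ν q) = 0 := by
  simp only [samplePosteriorMean]
  -- By conditional independence the integrand is the posterior mean of `g (x i) * g (x k)`. Its
  -- expectation is the prior one, which vanishes by independence and centring.
  simp_rw [← posteriorMean_mul_of_ne P q g g hik]
  refine (integral_posteriorMean (measurable_productLikelihood hq) hq1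
    (g := fun x => g (x i) * g (x k)) ?_ ?_).trans
    (integral_pi_mul_of_ne P g g hik hg0)
  · exact (hg.comp (measurable_pi_apply i)).mul (hg.comp (measurable_pi_apply k))
  · exact (memLp_eval hgi i).integrable_mul (memLp_eval hgi k)

variable {κ : Type*} [Fintype κ] {S : κ → 𝒳 → ℝ} (hS : ∀ j, Measurable (S j))
  (hS2 : ∀ j, MemLp (S j) 2 P) {s : ℝ} (hs : 0 < s)
  (hsub : ∀ m : κ → ℝ, Integrable (fun x => Real.exp (∑ j, m j * S j x)) P ∧
    ∫ x, Real.exp (∑ j, m j * S j x) ∂P ≤ Real.exp (s / 2 * ∑ j, m j ^ 2))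

include hS hS2 hs hsub

/-- For a sub-Gaussian score, the sum of the second moments of the posterior means of the scores of
the samples is at most `2 s` times the mutual information. -/
lemma sum_integral_sq_samplePosteriorMean_le_klDiv :
    ENNReal.ofReal (1 / (2 * s) * ∑ i, ∑ j, ∫ z, samplePosteriorMean P q i (S j) z.2 ^ 2
      ∂(productChannelLaw P ν q)) ≤
    InformationTheory.klDiv (productChannelLaw P ν q)
      (((productChannelLaw P ν q).map Prod.fst).prod ((productChannelLaw P ν q).map Prod.snd)) := by
  set J := productChannelLaw P ν q with hJ
  have hprob : IsProbabilityMeasure J := isProbabilityMeasure_productChannelLaw hq hq1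
  have hp1 : IsProbabilityMeasure (J.map Prod.fst) :=
    Measure.isProbabilityMeasure_map measurable_fst.aemeasurable
  have hp2 : IsProbabilityMeasure (J.map Prod.snd) :=
    Measure.isProbabilityMeasure_map measurable_snd.aemeasurable
  set m : Fin n → κ → Y → ℝ := fun i j => samplePosteriorMean P q i (S j) with hm
  have hmm : ∀ i j, Measurable (m i j) := fun i j => measurable_samplePosteriorMean hq (hS j) i
  have hm2 : ∀ i j, MemLp (fun z : (Fin n → 𝒳) × Y => m i j z.2) 2 J := fun i j =>
    memLp_samplePosteriorMean hq hq1 (hS j) (hS2 j) i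
  have hS2' : ∀ i j, MemLp (fun z : (Fin n → 𝒳) × Y => S j (z.1 i)) 2 J := fun i j =>
    memLp_sample hq hq1 (hS2 j) i
  have hi1 : ∀ i j, Integrable (fun z : (Fin n → 𝒳) × Y => m i j z.2 * S j (z.1 i)) J :=
    fun i j => (hm2 i j).integrable_mul (hS2' i j)
  have hi2 : ∀ i j, Integrable (fun z : (Fin n → 𝒳) × Y => m i j z.2 ^ 2) J :=
    fun i j => (hm2 i j).integrable_sq
  -- The scores are tilted by `m / s`, and the subtracted term is the sub-Gaussian bound `(s / 2) |m
  -- / s|²` for the log-moment generating function. Among the tilts `a * m`, `a = 1 / s` maximizes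
  -- the resulting `a - s * a² / 2`, with value `1 / (2 s)`.
  let F : (Fin n → 𝒳) × Y → ℝ := fun z =>
    ∑ i, ∑ j, (1 / s * (m i j z.2 * S j (z.1 i)) - 1 / (2 * s) * m i j z.2 ^ 2)
  have hFm : Measurable F := by
    refine Finset.measurable_fun_sum _ fun i _ => Finset.measurable_fun_sum _ fun j _ => ?_
    refine Measurable.sub (Measurable.const_mul (Measurable.mul ?_ ?_) _)
      (Measurable.const_mul (Measurable.pow_const ?_ 2) _)
    · exact (hmm i j).comp measurable_snd
    · exact (hS j).comp ((measurable_pi_apply i).comp measurable_fst)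
    · exact (hmm i j).comp measurable_snd
  have hFi : ∀ i j, Integrable (fun z : (Fin n → 𝒳) × Y =>
      1 / s * (m i j z.2 * S j (z.1 i)) - 1 / (2 * s) * m i j z.2 ^ 2) J := fun i j =>
    ((hi1 i j).const_mul _).sub ((hi2 i j).const_mul _)
  have hF : Integrable F J :=
    integrable_finsetSum _ fun i _ => integrable_finsetSum _ fun j _ => hFi i j
  have hFint : ∫ z, F z ∂J = 1 / (2 * s) * ∑ i, ∑ j, ∫ z, m i j z.2 ^ 2 ∂J := by
    rw [integral_finsetSum _ fun i _ => integrable_finsetSum _ fun j _ => hFi i j,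
      Finset.mul_sum]
    refine Finset.sum_congr rfl fun i _ => ?_
    rw [integral_finsetSum _ fun j _ => hFi i j, Finset.mul_sum]
    refine Finset.sum_congr rfl fun j _ => ?_
    rw [integral_sub ((hi1 i j).const_mul _) ((hi2 i j).const_mul _), integral_const_mul,
      integral_const_mul, integral_mul_sample hq hq1 (hS j) (hS2 j) i (hmm i j) (hm2 i j)]
    have e : ∫ z, m i j z.2 * samplePosteriorMean P q i (S j) z.2 ∂J = ∫ z, m i j z.2 ^ 2 ∂J := by
      simp_rw [sq, hm]
    rw [← hJ, e]
    field_simp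
    ring
  rw [← hFint]
  refine ofReal_integral_le_klDiv hFm hF ?_
  rw [(measurePreserving_fst_productChannelLaw hq hq1).map_eq,
    lintegral_prod_symm _ (hFm.exp.ennreal_ofReal).aemeasurable]
  -- Under the product of the marginals the samples keep their prior law when `y` is fixed. The
  -- tilts are then constants, the integral factors over the samples, and each factor is at most `1`
  -- by `hsub`.
  refine (lintegral_mono (g := fun _ => 1) fun y => ?_).trans (by simp)
  have hexp : ∀ x : Fin n → 𝒳, Real.exp (F (x, y)) =
      ∏ i, (Real.exp (∑ j, (1 / s * m i j y) * S j (x i)) *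
        Real.exp (-(1 / (2 * s) * ∑ j, m i j y ^ 2))) := by
    intro x
    simp_rw [← Real.exp_add]
    rw [← Real.exp_sum]
    congr 1
    refine Finset.sum_congr rfl fun i _ => ?_
    rw [Finset.sum_sub_distrib, Finset.mul_sum, ← sub_eq_add_neg]
    congr 1
    exact Finset.sum_congr rfl fun j _ => by ring
  simp_rw [hexp]
  rw [← ofReal_integral_eq_lintegral_ofReal
    (Integrable.fintype_prod fun i => ((hsub fun j => 1 / s * m i j y).1.mul_const _))
    (Filter.Eventually.of_forall fun x => Finset.prod_nonneg fun i _ => by positivity),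
    integral_fintype_prod_eq_prod (fun i x => Real.exp (∑ j, (1 / s * m i j y) * S j x) *
        Real.exp (-(1 / (2 * s) * ∑ j, m i j y ^ 2)))]
  refine ENNReal.ofReal_le_one.2 (Finset.prod_le_one (fun i _ => ?_) fun i _ => ?_)
  · exact integral_nonneg fun x => by positivity
  · rw [integral_mul_const]
    refine (mul_le_mul_of_nonneg_right (hsub fun j => 1 / s * m i j y).2
      (Real.exp_pos _).le).trans ?_
    rw [← Real.exp_add]
    refine (Real.exp_le_exp.2 (le_of_eq ?_)).trans_eq Real.exp_zero
    simp_rw [mul_pow]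
    rw [← Finset.mul_sum]
    field_simp
    ring

/-- The van Trees type pairing of a statistic of the output with the score, bounded through the
mutual information. -/
lemma sum_integral_mul_score_le (hS0 : ∀ j, ∫ x, S j x ∂P = 0) {K : ℝ}
    (hK0 : 0 ≤ K) (hK : InformationTheory.klDiv (productChannelLaw P ν q)
      (((productChannelLaw P ν q).map Prod.fst).prod ((productChannelLaw P ν q).map Prod.snd)) ≤
        ENNReal.ofReal K)
    {h : κ → Y → ℝ} (hh : ∀ j, Measurable (h j))
    (hh2 : ∀ j, MemLp (fun z : (Fin n → 𝒳) × Y => h j z.2) 2 (productChannelLaw P ν q))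
    (c : κ → ℝ) {l : ℝ} (hl : 0 < l) :
    ∑ j, ∫ z, h j z.2 * (c j + ∑ i, S j (z.1 i)) ∂(productChannelLaw P ν q) ≤
      l / 2 * ∑ j, ∫ z, h j z.2 ^ 2 ∂(productChannelLaw P ν q) +
        1 / (2 * l) * (∑ j, c j ^ 2 + 2 * s * K) := by
  have hinfo := (sum_integral_sq_samplePosteriorMean_le_klDiv hq hq1 hS hS2 hs hsub).trans hK
  rw [ENNReal.ofReal_le_ofReal_iff hK0] at hinfo
  set J := productChannelLaw P ν q with hJ
  have hprob : IsProbabilityMeasure J := isProbabilityMeasure_productChannelLaw hq hq1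
  set m : Fin n → κ → Y → ℝ := fun i j => samplePosteriorMean P q i (S j) with hm
  have hmm : ∀ i j, Measurable (m i j) := fun i j => measurable_samplePosteriorMean hq (hS j) i
  have hm2 : ∀ i j, MemLp (fun z : (Fin n → 𝒳) × Y => m i j z.2) 2 J := fun i j =>
    memLp_samplePosteriorMean hq hq1 (hS j) (hS2 j) i
  have hS2' : ∀ i j, MemLp (fun z : (Fin n → 𝒳) × Y => S j (z.1 i)) 2 J := fun i j =>
    memLp_sample hq hq1 (hS2 j) i
  have hinfo' : ∑ i, ∑ j, ∫ z, m i j z.2 ^ 2 ∂J ≤ 2 * s * K := by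
    have := mul_le_mul_of_nonneg_left hinfo (by positivity : 0 ≤ 2 * s)
    rwa [← mul_assoc, mul_one_div_cancel (by positivity), one_mul] at this
  have hW2 : ∀ j, MemLp (fun z : (Fin n → 𝒳) × Y => ∑ i, m i j z.2) 2 J := fun j =>
    memLp_finsetSum _ fun i _ => hm2 i j
  have hcW2 : ∀ j, MemLp (fun z : (Fin n → 𝒳) × Y => c j + ∑ i, m i j z.2) 2 J := fun j =>
    (memLp_const (c j)).add (hW2 j)
  -- As `h j` depends on the output only, each score may be replaced by its posterior mean. Applying
  -- Cauchy–Schwarz or Young before this projection would cost the Fisher information of all the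
  -- samples.
  have hproj : ∀ j, ∫ z, h j z.2 * (c j + ∑ i, S j (z.1 i)) ∂J =
      ∫ z, h j z.2 * (c j + ∑ i, m i j z.2) ∂J := by
    intro j
    simp_rw [mul_add, Finset.mul_sum]
    have hc : Integrable (fun z : (Fin n → 𝒳) × Y => h j z.2 * c j) J :=
      ((hh2 j).integrable one_le_two).mul_const _
    have h1 : ∀ i, Integrable (fun z : (Fin n → 𝒳) × Y => h j z.2 * S j (z.1 i)) J := fun i =>
      (hh2 j).integrable_mul (hS2' i j)
    have h2 : ∀ i, Integrable (fun z : (Fin n → 𝒳) × Y => h j z.2 * m i j z.2) J := fun i =>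
      (hh2 j).integrable_mul (hm2 i j)
    rw [integral_add hc (integrable_finsetSum _ fun i _ => h1 i),
      integral_add hc (integrable_finsetSum _ fun i _ => h2 i),
      integral_finsetSum _ fun i _ => h1 i, integral_finsetSum _ fun i _ => h2 i]
    congr 1
    exact Finset.sum_congr rfl fun i _ =>
      integral_mul_sample hq hq1 (hS j) (hS2 j) i (hh j) (hh2 j)
  -- The posterior means are centred and uncorrelated for different samples, so only the diagonal
  -- terms of the square remain.
  have hsq : ∀ j, ∫ z, (c j + ∑ i, m i j z.2) ^ 2 ∂J =
      c j ^ 2 + ∑ i, ∫ z, m i j z.2 ^ 2 ∂J := by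
    intro j
    have hex : ∀ z : (Fin n → 𝒳) × Y, (c j + ∑ i, m i j z.2) ^ 2 =
        c j ^ 2 + 2 * c j * ∑ i, m i j z.2 + ∑ i, ∑ k, m i j z.2 * m k j z.2 := by
      intro z
      rw [← Finset.sum_mul_sum]
      ring
    have hmul : ∀ i k, Integrable (fun z : (Fin n → 𝒳) × Y => m i j z.2 * m k j z.2) J :=
      fun i k => (hm2 i j).integrable_mul (hm2 k j)
    have hlin : Integrable (fun z : (Fin n → 𝒳) × Y => 2 * c j * ∑ i, m i j z.2) J :=
      ((hW2 j).integrable one_le_two).const_mul _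
    have hclin : Integrable (fun z : (Fin n → 𝒳) × Y => c j ^ 2 + 2 * c j * ∑ i, m i j z.2) J :=
      (integrable_const _).add hlin
    simp_rw [hex]
    rw [integral_add hclin
        (integrable_finsetSum _ fun i _ => integrable_finsetSum _ fun k _ => hmul i k),
      integral_add (integrable_const _) hlin, integral_const_mul,
      integral_finsetSum _ fun i _ => (hm2 i j).integrable one_le_two,
      integral_finsetSum _ fun i _ => integrable_finsetSum _ fun k _ => hmul i k]
    have hz : ∀ i, ∫ z, m i j z.2 ∂J = 0 := fun i =>
      (integral_samplePosteriorMean hq hq1 (hS j) (hS2 j) i).trans (hS0 j)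
    have hd : ∀ i, ∫ z, ∑ k, m i j z.2 * m k j z.2 ∂J = ∫ z, m i j z.2 ^ 2 ∂J := by
      intro i
      rw [integral_finsetSum _ fun k _ => hmul i k, Finset.sum_eq_single i]
      · simp_rw [sq]
      · intro k _ hk
        exact integral_samplePosteriorMean_mul_of_ne hq hq1 (hS j) (hS2 j) (hS0 j) hk.symm
      · simp
    simp [hz, hd]
  calc ∑ j, ∫ z, h j z.2 * (c j + ∑ i, S j (z.1 i)) ∂J
      ≤ ∑ j, (l / 2 * ∫ z, h j z.2 ^ 2 ∂J +
          1 / (2 * l) * ∫ z, (c j + ∑ i, m i j z.2) ^ 2 ∂J) := by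
        refine Finset.sum_le_sum fun j _ => ?_
        rw [hproj j, ← integral_const_mul, ← integral_const_mul,
          ← integral_add ((hh2 j).integrable_sq.const_mul _) ((hcW2 j).integrable_sq.const_mul _)]
        refine integral_mono ((hh2 j).integrable_mul (hcW2 j))
          (((hh2 j).integrable_sq.const_mul _).add ((hcW2 j).integrable_sq.const_mul _)) fun z => ?_
        have key : ∀ a b : ℝ, a * b ≤ l / 2 * a ^ 2 + 1 / (2 * l) * b ^ 2 := by
          intro a b
          have e : l / 2 * a ^ 2 + 1 / (2 * l) * b ^ 2 - a * b = (l * a - b) ^ 2 / (2 * l) := by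
            field_simp
            ring
          have : 0 ≤ (l * a - b) ^ 2 / (2 * l) := by positivity
          linarith
        exact key _ _
    _ = l / 2 * ∑ j, ∫ z, h j z.2 ^ 2 ∂J +
          1 / (2 * l) * (∑ j, c j ^ 2 + ∑ i, ∑ j, ∫ z, m i j z.2 ^ 2 ∂J) := by
        rw [Finset.sum_add_distrib, ← Finset.mul_sum, ← Finset.mul_sum, Finset.sum_comm,
          ← Finset.sum_add_distrib]
        simp_rw [hsq]
    _ ≤ _ := by gcongr

end

end ScoreBound

-- The Gaussian location model: densities and scores.

section GaussianLocation

lemma gaussianReal_eq_withDensity_gaussianReal_zero (a : ℝ) {v : NNReal} (hv : v ≠ 0) :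
    gaussianReal a v = (gaussianReal 0 v).withDensity
      fun x => ENNReal.ofReal (Real.exp (a * x / v - a ^ 2 / (2 * v))) := by
  rw [gaussianReal_of_var_ne_zero a hv, gaussianReal_of_var_ne_zero 0 hv,
    ← withDensity_mul _ (measurable_gaussianPDF 0 v) (by fun_prop)]
  congr 1
  ext x
  have hv' : (v : ℝ) ≠ 0 := by exact_mod_cast hv
  rw [Pi.mul_apply, gaussianPDF, gaussianPDF, ← ENNReal.ofReal_mul (gaussianPDFReal_nonneg _ _ _),
    gaussianPDFReal, gaussianPDFReal, mul_assoc (√_)⁻¹, ← Real.exp_add]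
  congr 3
  field_simp
  ring

lemma integrable_exp_mul_sub_gaussianReal (a t : ℝ) (v : NNReal) :
    Integrable (fun x => Real.exp (t * (x - a))) (gaussianReal a v) := by
  simp_rw [mul_sub, Real.exp_sub]
  exact (integrable_exp_mul_gaussianReal t).div_const _

lemma integral_exp_mul_sub_gaussianReal (a t : ℝ) (v : NNReal) :
    ∫ x, Real.exp (t * (x - a)) ∂(gaussianReal a v) = Real.exp (v * t ^ 2 / 2) := by
  have h : ∫ x, Real.exp (t * x) ∂(gaussianReal a v) = Real.exp (a * t + v * t ^ 2 / 2) :=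
    congrFun (mgf_id_gaussianReal (μ := a) (v := v)) t
  simp_rw [mul_sub, Real.exp_sub]
  rw [integral_div, h, ← Real.exp_sub]
  congr 1
  ring

lemma gaussianLocation_eq_map_pi {d : ℕ} (σ : ℝ) (θ : EuclideanSpace ℝ (Fin d)) :
    gaussianLocation σ θ =
      (Measure.pi fun j => gaussianReal (θ j) (σ ^ 2).toNNReal).map (WithLp.toLp 2) := by
  have hS : (σ ^ 2 • (1 : Matrix (Fin d) (Fin d) ℝ)).PosSemidef :=
    Matrix.PosSemidef.one.smul (sq_nonneg σ)
  have hprob : IsProbabilityMeasure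
      ((Measure.pi fun j => gaussianReal (θ j) (σ ^ 2).toNNReal).map
        (WithLp.toLp 2 : (Fin d → ℝ) → EuclideanSpace ℝ (Fin d))) :=
    Measure.isProbabilityMeasure_map (by fun_prop)
  unfold gaussianLocation
  refine Measure.ext_of_charFun ?_
  ext t
  rw [charFun_multivariateGaussian hS, charFun_pi]
  simp_rw [charFun_gaussianReal]
  rw [← Complex.exp_sum, Finset.sum_sub_distrib]
  congr 2
  · simp only [PiLp.inner_apply, ← Finset.sum_mul]
    congr 1
    push_cast
    exact Finset.sum_congr rfl fun j _ => by simp [mul_comm]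
  · simp only [Matrix.smul_mulVec, Matrix.one_mulVec, Pi.smul_apply, smul_eq_mul,
      Real.coe_toNNReal _ (sq_nonneg σ), dotProduct, ← Finset.sum_div]
    push_cast
    exact congrArg (· / 2) (Finset.sum_congr rfl fun j _ => by ring)

instance isProbabilityMeasure_gaussianLocation {d : ℕ} (σ : ℝ) (θ : EuclideanSpace ℝ (Fin d)) :
    IsProbabilityMeasure (gaussianLocation σ θ) := by
  unfold gaussianLocation
  infer_instance

lemma map_withDensity_comp {α β : Type*} [MeasurableSpace α] [MeasurableSpace β] {μ : Measure α}
    {f : α → β} (hf : Measurable f) {g : β → ℝ≥0∞} (hg : Measurable g) :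
    (μ.withDensity fun x => g (f x)).map f = (μ.map f).withDensity g := by
  ext s hs
  rw [Measure.map_apply hf hs, withDensity_apply _ (hf hs), withDensity_apply _ hs,
    setLIntegral_map hs hg hf]

/-- The density of `N(θ, σ² I)` with respect to `N(0, σ² I)`. -/
noncomputable def locationDensity {d : ℕ} (σ : ℝ) (θ x : EuclideanSpace ℝ (Fin d)) : ℝ :=
  ∏ j, Real.exp (θ j * x j / σ ^ 2 - θ j ^ 2 / (2 * σ ^ 2))

lemma locationDensity_pos {d : ℕ} (σ : ℝ) (θ x : EuclideanSpace ℝ (Fin d)) :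
    0 < locationDensity σ θ x :=
  Finset.prod_pos fun _ _ => Real.exp_pos _

lemma measurable_locationDensity {d : ℕ} (σ : ℝ) (θ : EuclideanSpace ℝ (Fin d)) :
    Measurable (locationDensity σ θ) := by
  unfold locationDensity
  fun_prop

lemma gaussianLocation_eq_withDensity {d : ℕ} {σ : ℝ} (hσ : 0 < σ)
    (θ : EuclideanSpace ℝ (Fin d)) :
    gaussianLocation σ θ = (gaussianLocation σ 0).withDensity
      fun x => ENNReal.ofReal (locationDensity σ θ x) := by
  have hv : (σ ^ 2).toNNReal ≠ 0 := by simpa using hσ.ne'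
  rw [gaussianLocation_eq_map_pi, gaussianLocation_eq_map_pi,
    ← map_withDensity_comp (by fun_prop) (measurable_locationDensity σ θ).ennreal_ofReal]
  congr 1
  rw [funext fun j => gaussianReal_eq_withDensity_gaussianReal_zero (θ j) hv,
    pi_withDensity_ofReal _ _ (fun _ _ => (Real.exp_pos _).le)]
  · simp [locationDensity, Real.coe_toNNReal _ (sq_nonneg σ)]
  · intro j
    have : (fun x : ℝ => Real.exp (θ j * x / ((σ ^ 2).toNNReal : ℝ) -
        θ j ^ 2 / (2 * ((σ ^ 2).toNNReal : ℝ)))) =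
      fun x : ℝ => Real.exp (θ j / ((σ ^ 2).toNNReal : ℝ) * x) /
        Real.exp (θ j ^ 2 / (2 * ((σ ^ 2).toNNReal : ℝ))) := by
      ext x
      rw [← Real.exp_sub]
      congr 1
      ring
    rw [this]
    exact (integrable_exp_mul_gaussianReal _).div_const _

/-- The score of the Gaussian location model. -/
noncomputable def gaussianScore {d : ℕ} (σ : ℝ) (θ : EuclideanSpace ℝ (Fin d)) (j : Fin d)
    (x : EuclideanSpace ℝ (Fin d)) : ℝ :=
  (x j - θ j) / σ ^ 2

variable {d : ℕ} {σ : ℝ} (θ : EuclideanSpace ℝ (Fin d))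

lemma measurable_gaussianScore (j : Fin d) : Measurable (gaussianScore σ θ j) := by
  unfold gaussianScore
  fun_prop

lemma measurePreserving_coord_gaussianLocation (j : Fin d) :
    MeasurePreserving (fun x : EuclideanSpace ℝ (Fin d) => x j) (gaussianLocation σ θ)
      (gaussianReal (θ j) (σ ^ 2).toNNReal) := by
  refine ⟨by fun_prop, ?_⟩
  rw [gaussianLocation_eq_map_pi, Measure.map_map (by fun_prop) (by fun_prop)]
  exact (measurePreserving_eval (fun j => gaussianReal (θ j) (σ ^ 2).toNNReal) j).map_eq

lemma memLp_gaussianScore (j : Fin d) : MemLp (gaussianScore σ θ j) 2 (gaussianLocation σ θ) := by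
  have h : MemLp (fun x : ℝ => (x - θ j) / σ ^ 2) 2 (gaussianReal (θ j) (σ ^ 2).toNNReal) := by
    have h1 : MemLp (fun x : ℝ => x - θ j) 2 (gaussianReal (θ j) (σ ^ 2).toNNReal) :=
      (memLp_id_gaussianReal 2).sub (memLp_const (θ j))
    simp_rw [div_eq_mul_inv]
    exact h1.mul_const _
  exact h.comp_measurePreserving (measurePreserving_coord_gaussianLocation θ j)

lemma integral_coord_gaussianLocation {g : ℝ → ℝ} (hg : Measurable g) (j : Fin d) :
    ∫ x, g (x j) ∂(gaussianLocation σ θ) = ∫ x, g x ∂(gaussianReal (θ j) (σ ^ 2).toNNReal) := by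
  have hmp := measurePreserving_coord_gaussianLocation (σ := σ) θ j
  rw [← hmp.map_eq, integral_map hmp.measurable.aemeasurable hg.aestronglyMeasurable]

lemma integral_gaussianScore (j : Fin d) :
    ∫ x, gaussianScore σ θ j x ∂(gaussianLocation σ θ) = 0 := by
  unfold gaussianScore
  rw [integral_coord_gaussianLocation θ (g := fun x => (x - θ j) / σ ^ 2) (by fun_prop),
    integral_div, integral_sub (f := fun x : ℝ => x) ((memLp_id_gaussianReal 1).integrable le_rfl)
      (integrable_const _), integral_id_gaussianReal]
  simp

lemma integral_sq_gaussianScore (hσ : 0 < σ) (j : Fin d) :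
    ∫ x, gaussianScore σ θ j x ^ 2 ∂(gaussianLocation σ θ) = 1 / σ ^ 2 := by
  unfold gaussianScore
  have hvar := variance_id_gaussianReal (μ := θ j) (v := (σ ^ 2).toNNReal)
  rw [variance_eq_integral measurable_id.aemeasurable] at hvar
  simp only [id, integral_id_gaussianReal, Real.coe_toNNReal _ (sq_nonneg σ)] at hvar
  rw [integral_coord_gaussianLocation θ (g := fun x => ((x - θ j) / σ ^ 2) ^ 2) (by fun_prop)]
  simp_rw [div_pow]
  rw [integral_div, hvar]
  field_simp

/-- The scores of the coordinates are independent centred Gaussians of variance `1 / σ ^ 2`, so the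
bound is in fact an equality. This is where the sub-Gaussian constant `s = 1 / σ ^ 2` comes from. -/
lemma gaussianScore_subGaussian (hσ : 0 < σ) (m : Fin d → ℝ) :
    Integrable (fun x => Real.exp (∑ j, m j * gaussianScore σ θ j x)) (gaussianLocation σ θ) ∧
      ∫ x, Real.exp (∑ j, m j * gaussianScore σ θ j x) ∂(gaussianLocation σ θ) ≤
        Real.exp (1 / σ ^ 2 / 2 * ∑ j, m j ^ 2) := by
  have hmeas : Measurable fun x : EuclideanSpace ℝ (Fin d) =>
      Real.exp (∑ j, m j * gaussianScore σ θ j x) := by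
    unfold gaussianScore
    fun_prop
  have htoLp : Measurable (WithLp.toLp 2 : (Fin d → ℝ) → EuclideanSpace ℝ (Fin d)) := by fun_prop
  have heq : ∀ x : Fin d → ℝ, Real.exp (∑ j, m j * gaussianScore σ θ j (WithLp.toLp 2 x)) =
      ∏ j, Real.exp (m j / σ ^ 2 * (x j - θ j)) := by
    intro x
    rw [← Real.exp_sum]
    congr 1
    refine Finset.sum_congr rfl fun j _ => ?_
    simp only [gaussianScore]
    ring
  rw [gaussianLocation_eq_map_pi, integrable_map_measure hmeas.aestronglyMeasurable
    htoLp.aemeasurable, integral_map htoLp.aemeasurable hmeas.aestronglyMeasurable]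
  simp only [Function.comp_def]
  simp_rw [heq]
  refine ⟨Integrable.fintype_prod fun j => integrable_exp_mul_sub_gaussianReal _ _ _, ?_⟩
  rw [integral_fintype_prod_eq_prod (fun j x => Real.exp (m j / σ ^ 2 * (x - θ j)))]
  simp_rw [integral_exp_mul_sub_gaussianReal]
  rw [← Real.exp_sum, Finset.mul_sum]
  refine Real.exp_le_exp.2 (le_of_eq (Finset.sum_congr rfl fun j _ => ?_))
  rw [Real.coe_toNNReal _ (sq_nonneg σ)]
  field_simp

end GaussianLocation

-- Change of the parameter in the joint law.

section GaussianChannel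

variable {d n : ℕ} {σ : ℝ} {Y : Type*} [MeasurableSpace Y] {ν : Measure Y} [SigmaFinite ν]
  {q : Fin n → EuclideanSpace ℝ (Fin d) → Y → ℝ≥0∞}

/-- The joint law of samples and channel output at `θ` has a density with respect to that at `0`. -/
lemma productChannelLaw_gaussianLocation_eq_withDensity (hσ : 0 < σ)
    (hq : ∀ i, Measurable fun z : EuclideanSpace ℝ (Fin d) × Y => q i z.1 z.2)
    (θ : EuclideanSpace ℝ (Fin d)) :
    productChannelLaw (gaussianLocation σ θ) ν q =
      (productChannelLaw (gaussianLocation σ 0) ν q).withDensity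
        fun z => ENNReal.ofReal (∏ i, locationDensity σ θ (z.1 i)) := by
  have hint : Integrable (locationDensity σ θ) (gaussianLocation σ 0) := by
    refine ⟨(measurable_locationDensity σ θ).aestronglyMeasurable, ?_⟩
    rw [hasFiniteIntegral_iff_ofReal
      (Filter.Eventually.of_forall fun x => (locationDensity_pos σ θ x).le)]
    have h := measure_univ (μ := gaussianLocation σ θ)
    rw [gaussianLocation_eq_withDensity hσ, withDensity_apply _ MeasurableSet.univ,
      Measure.restrict_univ] at h
    rw [h]
    exact ENNReal.one_lt_top
  have hm : Measurable fun x : Fin n → EuclideanSpace ℝ (Fin d) =>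
      ENNReal.ofReal (∏ i, locationDensity σ θ (x i)) :=
    (Finset.measurable_fun_prod _ fun i _ =>
      (measurable_locationDensity σ θ).comp (measurable_pi_apply i)).ennreal_ofReal
  have hpi : (Measure.pi fun _ : Fin n => gaussianLocation σ θ) =
      (Measure.pi fun _ : Fin n => gaussianLocation σ 0).withDensity
        fun x => ENNReal.ofReal (∏ i, locationDensity σ θ (x i)) := by
    rw [← pi_withDensity_ofReal _ _ (fun _ x => (locationDensity_pos σ θ x).le) fun _ => hint]
    simp_rw [← gaussianLocation_eq_withDensity hσ θ]
  have hD := measurable_productLikelihood hq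
  have hm' : Measurable fun z : (Fin n → EuclideanSpace ℝ (Fin d)) × Y =>
      ENNReal.ofReal (∏ i, locationDensity σ θ (z.1 i)) := hm.comp measurable_fst
  unfold productChannelLaw
  rw [hpi, prod_withDensity_left hm,
    ← withDensity_mul _ hm' hD, ← withDensity_mul _ hD hm', mul_comm]

end GaussianChannel

-- The cosine-squared prior and integration by parts on the cube.

section CosinePrior

/-- The density of the cosine-squared prior on `[-1, 1]`. -/
noncomputable def cosPrior (t : ℝ) : ℝ := Real.cos (Real.pi / 2 * t) ^ 2

/-- The derivative of `cosPrior`. -/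
noncomputable def cosPriorDeriv (t : ℝ) : ℝ :=
  -(Real.pi * (Real.cos (Real.pi / 2 * t) * Real.sin (Real.pi / 2 * t)))

/-- The Fisher information density of `cosPrior`. -/
noncomputable def cosPriorInfo (t : ℝ) : ℝ := Real.pi ^ 2 * Real.sin (Real.pi / 2 * t) ^ 2

lemma continuous_cosPrior : Continuous cosPrior := by unfold cosPrior; fun_prop
lemma continuous_cosPriorDeriv : Continuous cosPriorDeriv := by unfold cosPriorDeriv; fun_prop
lemma continuous_cosPriorInfo : Continuous cosPriorInfo := by unfold cosPriorInfo; fun_prop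

lemma cosPrior_nonneg (t : ℝ) : 0 ≤ cosPrior t := sq_nonneg _

lemma cosPrior_le_one (t : ℝ) : cosPrior t ≤ 1 := Real.cos_sq_le_one _

lemma cosPriorInfo_nonneg (t : ℝ) : 0 ≤ cosPriorInfo t := by unfold cosPriorInfo; positivity

lemma abs_cosPriorDeriv_le (t : ℝ) : |cosPriorDeriv t| ≤ Real.pi := by
  rw [cosPriorDeriv, abs_neg, abs_mul, abs_mul, abs_of_pos Real.pi_pos]
  have := mul_le_one₀ (Real.abs_cos_le_one (Real.pi / 2 * t)) (abs_nonneg _)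
    (Real.abs_sin_le_one (Real.pi / 2 * t))
  nlinarith [Real.pi_pos]

/-- A division-free form of the Fisher information density `λ'² / λ`, valid at the zeros of the
prior too. -/
lemma cosPriorDeriv_sq (t : ℝ) : cosPriorDeriv t ^ 2 = cosPriorInfo t * cosPrior t := by
  unfold cosPriorDeriv cosPriorInfo cosPrior
  ring

lemma hasDerivAt_cosPrior (t : ℝ) : HasDerivAt cosPrior (cosPriorDeriv t) t := by
  have h := (((hasDerivAt_id t).const_mul (Real.pi / 2)).cos).pow 2
  refine h.congr_deriv ?_
  simp only [id, cosPriorDeriv]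
  push_cast
  ring

lemma integral_cosPrior : ∫ t in Set.Ioc (-1 : ℝ) 1, cosPrior t = 1 := by
  have h := intervalIntegral.integral_comp_mul_left (a := -1) (b := 1)
    (fun x => Real.cos x ^ 2) (c := Real.pi / 2) (by positivity)
  rw [← intervalIntegral.integral_of_le (by norm_num)]
  unfold cosPrior
  rw [h, integral_cos_sq]
  simp

lemma integral_cosPriorInfo : ∫ t in Set.Ioc (-1 : ℝ) 1, cosPriorInfo t = Real.pi ^ 2 := by
  have h := intervalIntegral.integral_comp_mul_left (a := -1) (b := 1)
    (fun x => Real.sin x ^ 2) (c := Real.pi / 2) (by positivity)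
  rw [← intervalIntegral.integral_of_le (by norm_num)]
  unfold cosPriorInfo
  rw [intervalIntegral.integral_const_mul, h, integral_sin_sq]
  simp

/-- One-dimensional integration by parts against the cosine-squared prior. -/
lemma integral_cosPrior_by_parts (a A N : ℝ) :
    ∫ t in Set.Ioc (-1 : ℝ) 1, (a - t) * (cosPriorDeriv t + cosPrior t * (A - N * t)) *
        Real.exp (t * A - N * t ^ 2 / 2) =
      ∫ t in Set.Ioc (-1 : ℝ) 1, cosPrior t * Real.exp (t * A - N * t ^ 2 / 2) := by
  have c1 := continuous_cosPrior
  have c2 := continuous_cosPriorDeriv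
  have hder : ∀ t ∈ Set.uIcc (-1 : ℝ) 1,
      HasDerivAt (fun t => (a - t) * cosPrior t * Real.exp (t * A - N * t ^ 2 / 2))
      ((a - t) * (cosPriorDeriv t + cosPrior t * (A - N * t)) * Real.exp (t * A - N * t ^ 2 / 2) -
        cosPrior t * Real.exp (t * A - N * t ^ 2 / 2)) t := by
    intro t _
    have h1 : HasDerivAt (fun t : ℝ => t * A - N * t ^ 2 / 2) (A - N * t) t := by
      refine (((hasDerivAt_id t).mul_const A).sub
        ((((hasDerivAt_id t).pow 2).const_mul N).div_const 2)).congr_deriv ?_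
      simp only [id]
      push_cast
      ring
    refine ((((hasDerivAt_id t).const_sub a).mul (hasDerivAt_cosPrior t)).mul
      h1.exp).congr_deriv ?_
    simp only [id, Pi.mul_apply]
    ring
  have hFTC := intervalIntegral.integral_eq_sub_of_hasDerivAt hder
    (Continuous.intervalIntegrable (by fun_prop) _ _)
  -- The prior vanishes at both endpoints, so there are no boundary terms.
  have e1 : cosPrior 1 = 0 := by simp [cosPrior]
  have e2 : cosPrior (-1) = 0 := by simp [cosPrior]
  rw [intervalIntegral.integral_sub (Continuous.intervalIntegrable (by fun_prop) _ _)
    (Continuous.intervalIntegrable (by fun_prop) _ _), e1, e2, mul_zero, mul_zero, zero_mul,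
    zero_mul, sub_zero, sub_eq_zero, intervalIntegral.integral_of_le (by norm_num),
    intervalIntegral.integral_of_le (by norm_num)] at hFTC
  exact hFTC

/-- Lebesgue measure on the cube `(-1, 1]^d`. -/
noncomputable def cubeMeasure (d : ℕ) : Measure (Fin d → ℝ) :=
  Measure.pi fun _ => volume.restrict (Set.Ioc (-1 : ℝ) 1)

instance isFiniteMeasure_cubeMeasure (d : ℕ) : IsFiniteMeasure (cubeMeasure d) := by
  unfold cubeMeasure
  infer_instance

lemma ae_mem_cube (d : ℕ) : ∀ᵐ u ∂(cubeMeasure d), ∀ j, u j ∈ Set.Ioc (-1 : ℝ) 1 := by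
  unfold cubeMeasure
  rw [← Measure.restrict_pi_pi]
  filter_upwards [ae_restrict_mem (MeasurableSet.univ_pi fun _ => measurableSet_Ioc)] with u hu j
  exact hu j (Set.mem_univ j)

variable {d : ℕ}

/-- The product prior density with the factor of coordinate `j` replaced by `a`. -/
noncomputable def coordProd (j : Fin d) (a : ℝ → ℝ) (u : Fin d → ℝ) : ℝ :=
  ∏ k, if k = j then a (u k) else cosPrior (u k)

/-- The product of the cosine-squared priors. -/
noncomputable def cubePrior (u : Fin d → ℝ) : ℝ := ∏ k, cosPrior (u k)

lemma coordProd_eq_mul (j : Fin d) (a : ℝ → ℝ) (u : Fin d → ℝ) :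
    coordProd j a u = a (u j) * ∏ k ∈ Finset.univ.erase j, cosPrior (u k) := by
  rw [coordProd, ← Finset.mul_prod_erase _ _ (Finset.mem_univ j), if_pos rfl]
  congr 1
  exact Finset.prod_congr rfl fun k hk => if_neg (Finset.ne_of_mem_erase hk)

lemma cubePrior_eq_mul (j : Fin d) (u : Fin d → ℝ) :
    cubePrior u = cosPrior (u j) * ∏ k ∈ Finset.univ.erase j, cosPrior (u k) :=
  (Finset.mul_prod_erase _ _ (Finset.mem_univ j)).symm

lemma continuous_cubePrior : Continuous (cubePrior (d := d)) :=
  continuous_finsetProd _ fun k _ => continuous_cosPrior.comp (continuous_apply k)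

lemma continuous_coordProd (j : Fin d) {a : ℝ → ℝ} (ha : Continuous a) :
    Continuous (coordProd j a) := by
  refine continuous_finsetProd _ fun k _ => ?_
  split_ifs
  · exact ha.comp (continuous_apply k)
  · exact continuous_cosPrior.comp (continuous_apply k)

lemma cubePrior_nonneg (u : Fin d → ℝ) : 0 ≤ cubePrior u :=
  Finset.prod_nonneg fun _ _ => cosPrior_nonneg _

lemma cubePrior_le_one (u : Fin d → ℝ) : cubePrior u ≤ 1 :=
  Finset.prod_le_one (fun _ _ => cosPrior_nonneg _) fun _ _ => cosPrior_le_one _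

lemma coordProd_nonneg (j : Fin d) {a : ℝ → ℝ} (ha : ∀ t, 0 ≤ a t) (u : Fin d → ℝ) :
    0 ≤ coordProd j a u := by
  rw [coordProd_eq_mul]
  exact mul_nonneg (ha _) (Finset.prod_nonneg fun _ _ => cosPrior_nonneg _)

lemma abs_coordProd_cosPriorDeriv_le (j : Fin d) (u : Fin d → ℝ) :
    |coordProd j cosPriorDeriv u| ≤ Real.pi := by
  have h0 : 0 ≤ ∏ k ∈ Finset.univ.erase j, cosPrior (u k) :=
    Finset.prod_nonneg fun _ _ => cosPrior_nonneg _
  have h1 : ∏ k ∈ Finset.univ.erase j, cosPrior (u k) ≤ 1 :=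
    Finset.prod_le_one (fun _ _ => cosPrior_nonneg _) fun _ _ => cosPrior_le_one _
  rw [coordProd_eq_mul, abs_mul, abs_of_nonneg h0]
  calc |cosPriorDeriv (u j)| * _ ≤ Real.pi * 1 :=
        mul_le_mul (abs_cosPriorDeriv_le _) h1 h0 Real.pi_pos.le
    _ = Real.pi := mul_one _

lemma coordProd_cosPriorDeriv_sq (j : Fin d) (u : Fin d → ℝ) :
    coordProd j cosPriorDeriv u ^ 2 = coordProd j cosPriorInfo u * cubePrior u := by
  rw [coordProd_eq_mul, coordProd_eq_mul, cubePrior_eq_mul j, mul_pow, cosPriorDeriv_sq]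
  ring

lemma integrable_cubeMeasure_of_continuous {f : (Fin d → ℝ) → ℝ} (hf : Continuous f) :
    Integrable f (cubeMeasure d) := by
  unfold cubeMeasure
  rw [← Measure.restrict_pi_pi]
  have hc : IsCompact (Set.univ.pi fun _ : Fin d => Set.Icc (-1 : ℝ) 1) :=
    isCompact_univ_pi fun _ => isCompact_Icc
  exact (hf.continuousOn.integrableOn_compact hc).mono_set
    (Set.pi_mono fun _ _ => Set.Ioc_subset_Icc_self)

lemma integral_cubePrior : ∫ u, cubePrior u ∂(cubeMeasure d) = 1 := by
  unfold cubePrior cubeMeasure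
  rw [integral_fintype_prod_eq_prod (fun _ => cosPrior)]
  simp [integral_cosPrior]

lemma integral_coordProd_cosPriorInfo (j : Fin d) :
    ∫ u, coordProd j cosPriorInfo u ∂(cubeMeasure d) = Real.pi ^ 2 := by
  unfold coordProd cubeMeasure
  rw [integral_fintype_prod_eq_prod (fun k t => if k = j then cosPriorInfo t else cosPrior t)]
  rw [← Finset.mul_prod_erase _ _ (Finset.mem_univ j), Finset.prod_eq_one]
  · simp [integral_cosPriorInfo]
  · intro k hk
    simp [Finset.ne_of_mem_erase hk, integral_cosPrior]

/-- The exponential tilt in the parameter `u`. -/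
noncomputable def expTilt (N : ℝ) (A u : Fin d → ℝ) : ℝ :=
  ∏ k, Real.exp (u k * A k - N * u k ^ 2 / 2)

lemma expTilt_pos (N : ℝ) (A u : Fin d → ℝ) : 0 < expTilt N A u :=
  Finset.prod_pos fun _ _ => Real.exp_pos _

lemma continuous_expTilt (N : ℝ) :
    Continuous fun p : (Fin d → ℝ) × (Fin d → ℝ) => expTilt N p.1 p.2 := by
  unfold expTilt
  fun_prop

/-- Integration by parts in coordinate `j` against the product prior. -/
lemma integral_cubePrior_by_parts (N a : ℝ) (A : Fin d → ℝ) (j : Fin d) :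
    ∫ u, expTilt N A u * ((a - u j) *
        (coordProd j cosPriorDeriv u + cubePrior u * (A j - N * u j))) ∂(cubeMeasure d) =
      ∫ u, cubePrior u * expTilt N A u ∂(cubeMeasure d) := by
  have hR : ∀ u : Fin d → ℝ, cubePrior u * expTilt N A u =
      ∏ k, cosPrior (u k) * Real.exp (u k * A k - N * u k ^ 2 / 2) := fun u =>
    Finset.prod_mul_distrib.symm
  have hL : ∀ u : Fin d → ℝ, expTilt N A u * ((a - u j) *
        (coordProd j cosPriorDeriv u + cubePrior u * (A j - N * u j))) =
      ∏ k, if k = j then (a - u k) * (cosPriorDeriv (u k) + cosPrior (u k) * (A k - N * u k)) *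
          Real.exp (u k * A k - N * u k ^ 2 / 2)
        else cosPrior (u k) * Real.exp (u k * A k - N * u k ^ 2 / 2) := by
    intro u
    rw [← Finset.mul_prod_erase Finset.univ (fun k => ite (k = j) _ _) (Finset.mem_univ j),
      if_pos rfl, Finset.prod_congr rfl fun k hk => if_neg (Finset.ne_of_mem_erase hk),
      Finset.prod_mul_distrib, expTilt, ← Finset.mul_prod_erase Finset.univ
      (fun k => Real.exp (u k * A k - N * u k ^ 2 / 2)) (Finset.mem_univ j), coordProd_eq_mul,
      cubePrior_eq_mul j]
    ring
  simp_rw [hR, hL]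
  unfold cubeMeasure
  rw [integral_fintype_prod_eq_prod (fun k t => if k = j then
        (a - t) * (cosPriorDeriv t + cosPrior t * (A k - N * t)) *
          Real.exp (t * A k - N * t ^ 2 / 2)
        else cosPrior t * Real.exp (t * A k - N * t ^ 2 / 2)),
    integral_fintype_prod_eq_prod (fun k t => cosPrior t * Real.exp (t * A k - N * t ^ 2 / 2))]
  refine Finset.prod_congr rfl fun k _ => ?_
  split_ifs
  · exact integral_cosPrior_by_parts _ _ _
  · rfl

end CosinePrior

-- The van Trees inequality for an exponential tilt.

section VanTrees

variable {d : ℕ} {Z : Type*} [MeasurableSpace Z] {J : Measure Z} [IsProbabilityMeasure J]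
  {A : Fin d → Z → ℝ} {N : ℝ}

lemma measurable_expTilt (hA : ∀ j, Measurable (A j)) :
    Measurable fun p : (Fin d → ℝ) × Z => expTilt N (fun k => A k p.2) p.1 :=
  (continuous_expTilt N).measurable.comp (f := fun p : (Fin d → ℝ) × Z => (fun k => A k p.2, p.1))
    ((measurable_pi_lambda _ fun k => (hA k).comp measurable_snd).prodMk measurable_fst)

/-- This justifies exchanging the integrals over the parameter and over the data. On the cube the
error is at most `2` because `t` is bounded, and `|x| ≤ 1 + x²` dominates the score by its square,
whose tilted mean is at most `B` uniformly in the parameter. -/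
lemma integrable_vanTrees_pairing (hA : ∀ j, Measurable (A j)) {t : Z → ℝ} (ht : Measurable t)
    (ht1 : ∀ z, |t z| ≤ 1)
    (h1 : ∀ u, Integrable (fun z => expTilt N (fun k => A k z) u) J)
    (h1' : ∀ u, ∫ z, expTilt N (fun k => A k z) u ∂J = 1) {j : Fin d} {B : ℝ}
    (h2 : ∀ u, Integrable (fun z => expTilt N (fun k => A k z) u * (A j z - N * u j) ^ 2) J)
    (h2' : ∀ u, ∫ z, expTilt N (fun k => A k z) u * (A j z - N * u j) ^ 2 ∂J ≤ B) :
    Integrable (fun p : (Fin d → ℝ) × Z => expTilt N (fun k => A k p.2) p.1 * ((t p.2 - p.1 j) *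
      (coordProd j cosPriorDeriv p.1 + cubePrior p.1 * (A j p.2 - N * p.1 j))))
      ((cubeMeasure d).prod J) := by
  have hL := measurable_expTilt (N := N) hA
  have hmeas : Measurable fun p : (Fin d → ℝ) × Z =>
      expTilt N (fun k => A k p.2) p.1 * ((t p.2 - p.1 j) *
        (coordProd j cosPriorDeriv p.1 + cubePrior p.1 * (A j p.2 - N * p.1 j))) := by
    have m1 := (continuous_coordProd j continuous_cosPriorDeriv).measurable
    have m2 := (continuous_cubePrior (d := d)).measurable
    have m3 := hA j
    fun_prop
  have hbound : ∀ u : Fin d → ℝ, (∀ k, u k ∈ Set.Ioc (-1 : ℝ) 1) → ∀ z,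
      ‖expTilt N (fun k => A k z) u * ((t z - u j) *
        (coordProd j cosPriorDeriv u + cubePrior u * (A j z - N * u j)))‖ ≤
      2 * (Real.pi + 1) * expTilt N (fun k => A k z) u +
        2 * (expTilt N (fun k => A k z) u * (A j z - N * u j) ^ 2) := by
    intro u hu z
    rw [norm_mul, norm_mul, Real.norm_of_nonneg (expTilt_pos _ _ _).le, Real.norm_eq_abs,
      Real.norm_eq_abs]
    have e1 : |t z - u j| ≤ 2 := by
      have := abs_le.1 (ht1 z)
      have := hu j
      rw [abs_le]
      constructor <;> linarith [this.1, this.2]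
    have e2 : |coordProd j cosPriorDeriv u + cubePrior u * (A j z - N * u j)| ≤
        Real.pi + 1 + (A j z - N * u j) ^ 2 := by
      refine (abs_add_le _ _).trans ?_
      rw [abs_mul, abs_of_nonneg (cubePrior_nonneg u)]
      have h3 := mul_le_mul_of_nonneg_right (cubePrior_le_one u) (abs_nonneg (A j z - N * u j))
      have h4 := abs_coordProd_cosPriorDeriv_le j u
      nlinarith [sq_nonneg (|A j z - N * u j| - 1), sq_abs (A j z - N * u j),
        abs_nonneg (A j z - N * u j)]
    calc _ ≤ expTilt N (fun k => A k z) u * (2 * (Real.pi + 1 + (A j z - N * u j) ^ 2)) := by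
          refine mul_le_mul_of_nonneg_left ?_ (expTilt_pos _ _ _).le
          exact mul_le_mul e1 e2 (abs_nonneg _) zero_le_two
      _ = _ := by ring
  have hdom : ∀ u : Fin d → ℝ, Integrable (fun z =>
      2 * (Real.pi + 1) * expTilt N (fun k => A k z) u +
        2 * (expTilt N (fun k => A k z) u * (A j z - N * u j) ^ 2)) J := fun u =>
    ((h1 u).const_mul _).add ((h2 u).const_mul _)
  have hint : ∀ u : Fin d → ℝ, (∀ k, u k ∈ Set.Ioc (-1 : ℝ) 1) →
      Integrable (fun z => expTilt N (fun k => A k z) u * ((t z - u j) *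
        (coordProd j cosPriorDeriv u + cubePrior u * (A j z - N * u j)))) J := fun u hu =>
    (hdom u).mono' (hmeas.comp measurable_prodMk_left).aestronglyMeasurable
      (Filter.Eventually.of_forall (hbound u hu))
  refine (integrable_prod_iff hmeas.aestronglyMeasurable).2 ⟨?_, ?_⟩
  · filter_upwards [ae_mem_cube d] with u hu using hint u hu
  · refine Integrable.of_bound
      (hmeas.norm.stronglyMeasurable.integral_prod_right' (ν := J)).aestronglyMeasurable
      (2 * (Real.pi + 1) * 1 + 2 * B) ?_
    filter_upwards [ae_mem_cube d] with u hu
    rw [Real.norm_of_nonneg (integral_nonneg fun z => norm_nonneg _)]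
    refine (integral_mono (hint u hu).norm (hdom u) (hbound u hu)).trans ?_
    rw [integral_add ((h1 u).const_mul _) ((h2 u).const_mul _), integral_const_mul,
      integral_const_mul, h1']
    have := h2' u
    linarith

/-- The van Trees identity for an exponential tilt and the cosine-squared prior. -/
lemma integral_vanTrees_pairing (hA : ∀ j, Measurable (A j)) {t : Z → ℝ} (ht : Measurable t)
    (ht1 : ∀ z, |t z| ≤ 1)
    (h1 : ∀ u, Integrable (fun z => expTilt N (fun k => A k z) u) J)
    (h1' : ∀ u, ∫ z, expTilt N (fun k => A k z) u ∂J = 1) {j : Fin d} {B : ℝ}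
    (h2 : ∀ u, Integrable (fun z => expTilt N (fun k => A k z) u * (A j z - N * u j) ^ 2) J)
    (h2' : ∀ u, ∫ z, expTilt N (fun k => A k z) u * (A j z - N * u j) ^ 2 ∂J ≤ B) :
    ∫ u, ∫ z, expTilt N (fun k => A k z) u * ((t z - u j) *
      (coordProd j cosPriorDeriv u + cubePrior u * (A j z - N * u j))) ∂J ∂(cubeMeasure d) = 1 := by
  have hint : Integrable (fun p : (Fin d → ℝ) × Z =>
      cubePrior p.1 * expTilt N (fun k => A k p.2) p.1) ((cubeMeasure d).prod J) := by
    have hmeas : Measurable fun p : (Fin d → ℝ) × Z =>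
        cubePrior p.1 * expTilt N (fun k => A k p.2) p.1 :=
      (continuous_cubePrior.measurable.comp measurable_fst).mul (measurable_expTilt hA)
    refine (integrable_prod_iff hmeas.aestronglyMeasurable).2
      ⟨Filter.Eventually.of_forall fun u => (h1 u).const_mul (cubePrior u), ?_⟩
    refine (integrable_cubeMeasure_of_continuous continuous_cubePrior).congr
      (Filter.Eventually.of_forall fun u => ?_)
    simp only [norm_mul, Real.norm_of_nonneg (cubePrior_nonneg u),
      Real.norm_of_nonneg (expTilt_pos _ _ _).le]
    rw [integral_const_mul, h1', mul_one]
  -- With `z` fixed, `t z` is a constant and the parts formula applies in `u`. Swapping back, the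
  -- tilt has mean `1`, and the total mass of the prior remains.
  rw [integral_integral_swap (integrable_vanTrees_pairing hA ht ht1 h1 h1' h2 h2')]
  simp_rw [integral_cubePrior_by_parts]
  rw [← integral_integral_swap hint]
  simp_rw [integral_const_mul, h1', mul_one]
  exact integral_cubePrior

/-- A Bayesian Cramér-Rao bound for an exponential tilt and the cosine-squared prior, from a bound
on the pairing of the error with the score at every parameter of the cube. -/
lemma vanTrees_le (hA : ∀ j, Measurable (A j)) {t : Fin d → Z → ℝ} (ht : ∀ j, Measurable (t j))
    (ht1 : ∀ j z, |t j z| ≤ 1)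
    (h1 : ∀ u, Integrable (fun z => expTilt N (fun k => A k z) u) J)
    (h1' : ∀ u, ∫ z, expTilt N (fun k => A k z) u ∂J = 1) {B : ℝ}
    (h2 : ∀ j u, Integrable (fun z => expTilt N (fun k => A k z) u * (A j z - N * u j) ^ 2) J)
    (h2' : ∀ j u, ∫ z, expTilt N (fun k => A k z) u * (A j z - N * u j) ^ 2 ∂J ≤ B)
    {R K l : ℝ} (hl : 0 < l)
    (hpair : ∀ u : Fin d → ℝ, (∀ k, u k ∈ Set.Icc (-1 : ℝ) 1) → ∀ c : Fin d → ℝ,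
      ∑ j, ∫ z, expTilt N (fun k => A k z) u * ((t j z - u j) * (c j + (A j z - N * u j))) ∂J ≤
        l / 2 * R + 1 / (2 * l) * (∑ j, c j ^ 2 + K)) :
    (d : ℝ) ≤ l / 2 * R + 1 / (2 * l) * (d * Real.pi ^ 2 + K) := by
  have hI := fun j => integrable_vanTrees_pairing hA (ht j) (ht1 j) h1 h1' (h2 j) (h2' j)
  have hsum : ∫ u, ∑ j, ∫ z, expTilt N (fun k => A k z) u * ((t j z - u j) *
      (coordProd j cosPriorDeriv u + cubePrior u * (A j z - N * u j))) ∂J ∂(cubeMeasure d) = d := by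
    rw [integral_finsetSum _ fun j _ => (hI j).integral_prod_left]
    simp_rw [fun j => integral_vanTrees_pairing hA (ht j) (ht1 j) h1 h1' (h2 j) (h2' j)]
    simp
  have hcInfo : Continuous fun u : Fin d → ℝ => ∑ j, coordProd j cosPriorInfo u :=
    continuous_finsetSum _ fun j _ => continuous_coordProd j continuous_cosPriorInfo
  have hcPrior := continuous_cubePrior (d := d)
  have hRHS : ∫ u, (l / 2 * R * cubePrior u + 1 / (2 * l) *
      (∑ j, coordProd j cosPriorInfo u + K * cubePrior u)) ∂(cubeMeasure d) =
      l / 2 * R + 1 / (2 * l) * (d * Real.pi ^ 2 + K) := by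
    rw [integral_add (integrable_cubeMeasure_of_continuous (by fun_prop))
      (integrable_cubeMeasure_of_continuous (by fun_prop)), integral_const_mul,
      integral_const_mul, integral_add (integrable_cubeMeasure_of_continuous hcInfo)
      (integrable_cubeMeasure_of_continuous (by fun_prop)), integral_const_mul,
      integral_finsetSum _ fun j _ => integrable_cubeMeasure_of_continuous
        (continuous_coordProd j continuous_cosPriorInfo), integral_cubePrior]
    simp_rw [integral_coordProd_cosPriorInfo]
    simp
  rw [← hRHS]
  refine hsum.symm.trans_le ?_
  refine integral_mono_ae (integrable_finsetSum _ fun j _ => (hI j).integral_prod_left)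
    (integrable_cubeMeasure_of_continuous (by fun_prop)) ?_
  filter_upwards [ae_mem_cube d] with u hu
  have hInfo0 : ∀ j, 0 ≤ coordProd j cosPriorInfo u := fun j =>
    coordProd_nonneg j cosPriorInfo_nonneg u
  -- The intended `c j` is the prior score `∂_j λ / λ`, undefined where `λ = 0`. At such points
  -- every `∂_j λ` vanishes as well, so the left side is `0` while the right side is nonnegative.
  rcases (cubePrior_nonneg u).eq_or_lt with h0 | hpos
  · have hd0 : ∀ j, coordProd j cosPriorDeriv u = 0 := fun j => by
      have := coordProd_cosPriorDeriv_sq j u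
      rw [← h0, mul_zero] at this
      exact pow_eq_zero_iff two_ne_zero |>.1 this
    simp only [hd0, ← h0, zero_mul, add_zero, mul_zero, integral_zero, Finset.sum_const_zero,
      zero_add]
    have := Finset.sum_nonneg fun j (_ : j ∈ Finset.univ) => hInfo0 j
    positivity
  · have h := mul_le_mul_of_nonneg_left
      (hpair u (fun k => Set.Ioc_subset_Icc_self (hu k))
        fun j => coordProd j cosPriorDeriv u / cubePrior u) hpos.le
    have hl' : cubePrior u * ∑ j, ∫ z, expTilt N (fun k => A k z) u * ((t j z - u j) *
          (coordProd j cosPriorDeriv u / cubePrior u + (A j z - N * u j))) ∂J =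
        ∑ j, ∫ z, expTilt N (fun k => A k z) u * ((t j z - u j) *
          (coordProd j cosPriorDeriv u + cubePrior u * (A j z - N * u j))) ∂J := by
      rw [Finset.mul_sum]
      refine Finset.sum_congr rfl fun j _ => ?_
      rw [← integral_const_mul]
      refine integral_congr_ae (Filter.Eventually.of_forall fun z => ?_)
      field_simp
    have hr' : cubePrior u * ∑ j, (coordProd j cosPriorDeriv u / cubePrior u) ^ 2 =
        ∑ j, coordProd j cosPriorInfo u := by
      rw [Finset.mul_sum]
      refine Finset.sum_congr rfl fun j _ => ?_
      rw [div_pow, coordProd_cosPriorDeriv_sq]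
      field_simp
    rw [hl'] at h
    refine h.trans (le_of_eq ?_)
    rw [← hr']
    ring

end VanTrees

-- The van Trees bound for Gaussian samples behind a product channel.

section GaussianChannelPairing

variable {d n : ℕ} {σ : ℝ} {Y : Type*}

/-- The sufficient statistic of coordinate `j` of the samples, in natural parametrization. -/
noncomputable def gaussianStatistic (σ : ℝ) (j : Fin d)
    (z : (Fin n → EuclideanSpace ℝ (Fin d)) × Y) : ℝ :=
  ∑ i, z.1 i j / σ ^ 2

/-- The Gaussian family is exponential in its mean: completing the square leaves the sum of the
samples over `σ ^ 2` as statistic and `n / σ ^ 2` as quadratic coefficient. Expectations at all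
parameters thus become integrals against the one law at `0`. -/
lemma prod_locationDensity_eq_expTilt (u : Fin d → ℝ)
    (z : (Fin n → EuclideanSpace ℝ (Fin d)) × Y) :
    ∏ i, locationDensity σ (WithLp.toLp 2 u) (z.1 i) =
      expTilt (n / σ ^ 2) (fun k => gaussianStatistic σ k z) u := by
  unfold locationDensity expTilt gaussianStatistic
  rw [Finset.prod_comm]
  refine Finset.prod_congr rfl fun k _ => ?_
  rw [← Real.exp_sum, Finset.sum_sub_distrib, Finset.mul_sum]
  congr 2
  · exact Finset.sum_congr rfl fun i _ => by ring
  · simp only [Finset.sum_const, Finset.card_univ, Fintype.card_fin, nsmul_eq_mul]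
    ring

lemma sum_gaussianScore_eq (u : Fin d → ℝ) (j : Fin d)
    (z : (Fin n → EuclideanSpace ℝ (Fin d)) × Y) :
    ∑ i, gaussianScore σ (WithLp.toLp 2 u) j (z.1 i) =
      gaussianStatistic σ j z - n / σ ^ 2 * u j := by
  simp only [gaussianScore, gaussianStatistic, sub_div, Finset.sum_sub_distrib, Finset.sum_const,
    Finset.card_univ, Fintype.card_fin, nsmul_eq_mul]
  ring

variable [MeasurableSpace Y] {ν : Measure Y} [SigmaFinite ν]
  {q : Fin n → EuclideanSpace ℝ (Fin d) → Y → ℝ≥0∞}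

lemma measurable_gaussianStatistic (j : Fin d) :
    Measurable (gaussianStatistic (n := n) (Y := Y) σ j) := by
  unfold gaussianStatistic
  fun_prop

lemma productChannelLaw_eq_withDensity_expTilt (hσ : 0 < σ)
    (hq : ∀ i, Measurable fun z : EuclideanSpace ℝ (Fin d) × Y => q i z.1 z.2) (u : Fin d → ℝ) :
    productChannelLaw (gaussianLocation σ (WithLp.toLp 2 u)) ν q =
      (productChannelLaw (gaussianLocation σ 0) ν q).withDensity fun z =>
        ENNReal.ofReal (expTilt (n / σ ^ 2) (fun k => gaussianStatistic σ k z) u) := by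
  rw [productChannelLaw_gaussianLocation_eq_withDensity hσ hq]
  simp_rw [prod_locationDensity_eq_expTilt]

lemma measurable_expTilt_gaussianStatistic (u : Fin d → ℝ) :
    Measurable fun z : (Fin n → EuclideanSpace ℝ (Fin d)) × Y =>
      expTilt (n / σ ^ 2) (fun k => gaussianStatistic σ k z) u :=
  (measurable_expTilt fun k => measurable_gaussianStatistic k).comp measurable_prodMk_left

lemma integral_productChannelLaw_eq (hσ : 0 < σ)
    (hq : ∀ i, Measurable fun z : EuclideanSpace ℝ (Fin d) × Y => q i z.1 z.2) (u : Fin d → ℝ)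
    (g : (Fin n → EuclideanSpace ℝ (Fin d)) × Y → ℝ) :
    ∫ z, g z ∂(productChannelLaw (gaussianLocation σ (WithLp.toLp 2 u)) ν q) =
      ∫ z, expTilt (n / σ ^ 2) (fun k => gaussianStatistic σ k z) u * g z
        ∂(productChannelLaw (gaussianLocation σ 0) ν q) := by
  rw [productChannelLaw_eq_withDensity_expTilt hσ hq, integral_withDensity_eq_integral_toReal_smul
    (measurable_expTilt_gaussianStatistic u).ennreal_ofReal
    (Filter.Eventually.of_forall fun _ => ENNReal.ofReal_lt_top)]
  simp only [ENNReal.toReal_ofReal (expTilt_pos _ _ _).le, smul_eq_mul]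

lemma integrable_productChannelLaw_iff (hσ : 0 < σ)
    (hq : ∀ i, Measurable fun z : EuclideanSpace ℝ (Fin d) × Y => q i z.1 z.2) (u : Fin d → ℝ)
    (g : (Fin n → EuclideanSpace ℝ (Fin d)) × Y → ℝ) :
    Integrable g (productChannelLaw (gaussianLocation σ (WithLp.toLp 2 u)) ν q) ↔
      Integrable (fun z => expTilt (n / σ ^ 2) (fun k => gaussianStatistic σ k z) u * g z)
        (productChannelLaw (gaussianLocation σ 0) ν q) := by
  rw [productChannelLaw_eq_withDensity_expTilt hσ hq, integrable_withDensity_iff_integrable_smul'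
    (measurable_expTilt_gaussianStatistic u).ennreal_ofReal
    (Filter.Eventually.of_forall fun _ => ENNReal.ofReal_lt_top)]
  simp only [ENNReal.toReal_ofReal (expTilt_pos _ _ _).le, smul_eq_mul]

lemma memLp_sum_gaussianScore
    (hq : ∀ i, Measurable fun z : EuclideanSpace ℝ (Fin d) × Y => q i z.1 z.2)
    (hq1 : ∀ x, ∫⁻ y, productLikelihood q (x, y) ∂ν = 1) (θ : EuclideanSpace ℝ (Fin d))
    (j : Fin d) :
    MemLp (fun z : (Fin n → EuclideanSpace ℝ (Fin d)) × Y => ∑ i, gaussianScore σ θ j (z.1 i)) 2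
      (productChannelLaw (gaussianLocation σ θ) ν q) :=
  memLp_finsetSum _ fun i _ => memLp_sample hq hq1 (memLp_gaussianScore θ j) i

/-- Cauchy–Schwarz loses a factor `n` here, harmlessly: the bound serves only as the uniform
constant `B` for integrability and does not enter the final estimate. -/
lemma integral_sq_sum_gaussianScore_le (hσ : 0 < σ)
    (hq : ∀ i, Measurable fun z : EuclideanSpace ℝ (Fin d) × Y => q i z.1 z.2)
    (hq1 : ∀ x, ∫⁻ y, productLikelihood q (x, y) ∂ν = 1) (θ : EuclideanSpace ℝ (Fin d))
    (j : Fin d) :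
    ∫ z, (∑ i, gaussianScore σ θ j (z.1 i)) ^ 2 ∂(productChannelLaw (gaussianLocation σ θ) ν q) ≤
      n * (n * (1 / σ ^ 2)) := by
  have hm : Measurable fun x => gaussianScore σ θ j x ^ 2 :=
    (measurable_gaussianScore θ j).pow_const 2
  have hi : ∀ i, Integrable (fun z => gaussianScore σ θ j (z.1 i) ^ 2)
      (productChannelLaw (gaussianLocation σ θ) ν q) := fun i =>
    (memLp_sample hq hq1 (memLp_gaussianScore θ j) i).integrable_sq
  have he : ∀ i, ∫ z, gaussianScore σ θ j (z.1 i) ^ 2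
      ∂(productChannelLaw (gaussianLocation σ θ) ν q) = 1 / σ ^ 2 := by
    intro i
    have hm' : Measurable fun x : Fin n → EuclideanSpace ℝ (Fin d) =>
        gaussianScore σ θ j (x i) ^ 2 := hm.comp (measurable_pi_apply i)
    rw [← integral_sq_gaussianScore θ hσ j, ← integral_pi_eval (n := n) hm i,
      ← (measurePreserving_fst_productChannelLaw (P := gaussianLocation σ θ) hq hq1).map_eq,
      integral_map measurable_fst.aemeasurable hm'.aestronglyMeasurable]
  calc _ ≤ ∫ z, (n : ℝ) * ∑ i, gaussianScore σ θ j (z.1 i) ^ 2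
        ∂(productChannelLaw (gaussianLocation σ θ) ν q) := by
        refine integral_mono (memLp_sum_gaussianScore hq hq1 θ j).integrable_sq
          ((integrable_finsetSum _ fun i _ => hi i).const_mul _) fun z => ?_
        simpa using sq_sum_le_card_mul_sum_sq (s := Finset.univ)
          (f := fun i => gaussianScore σ θ j (z.1 i))
    _ = _ := by
        rw [integral_const_mul, integral_finsetSum _ fun i _ => hi i]
        simp_rw [he]
        simp

/-- The van Trees bound for a bounded statistic of the output of a product channel with Gaussian
samples, in terms of its risk and of the mutual information. -/
lemma sq_le_risk_mul_information (hσ : 0 < σ) (hd : d ≠ 0)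
    (hq : ∀ i, Measurable fun z : EuclideanSpace ℝ (Fin d) × Y => q i z.1 z.2)
    (hq1 : ∀ x, ∫⁻ y, productLikelihood q (x, y) ∂ν = 1)
    {t : Fin d → Y → ℝ} (ht : ∀ j, Measurable (t j)) (ht1 : ∀ j y, |t j y| ≤ 1) {R K : ℝ}
    (hK0 : 0 ≤ K)
    (hK : ∀ θ ∈ paramCube d, InformationTheory.klDiv
      (productChannelLaw (gaussianLocation σ θ) ν q)
      (((productChannelLaw (gaussianLocation σ θ) ν q).map Prod.fst).prod
        ((productChannelLaw (gaussianLocation σ θ) ν q).map Prod.snd)) ≤ ENNReal.ofReal K)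
    (hR : ∀ θ ∈ paramCube d, ∑ j, ∫ z, (t j z.2 - θ j) ^ 2
      ∂(productChannelLaw (gaussianLocation σ θ) ν q) ≤ R) :
    (d : ℝ) ^ 2 ≤ R * (2 / σ ^ 2 * K + Real.pi ^ 2 * d) := by
  have hd' : (0 : ℝ) < d := by exact_mod_cast Nat.pos_of_ne_zero hd
  have hC : 0 < 2 / σ ^ 2 * K + Real.pi ^ 2 * d := by positivity
  have hprob : ∀ θ, IsProbabilityMeasure (productChannelLaw (gaussianLocation σ θ) ν q) := fun θ =>
    isProbabilityMeasure_productChannelLaw hq hq1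
  -- This weight makes the information term of the van Trees bound equal to `d / 2`, half of the
  -- left side, so the claim follows without dividing by `R`.
  set l : ℝ := (2 / σ ^ 2 * K + Real.pi ^ 2 * d) / d with hl
  have hl0 : 0 < l := by positivity
  have hvt := vanTrees_le (J := productChannelLaw (gaussianLocation σ 0) ν q)
    (A := fun k => gaussianStatistic σ k) (N := n / σ ^ 2) (t := fun j z => t j z.2)
    (B := n * (n * (1 / σ ^ 2))) (R := R) (K := 2 * (1 / σ ^ 2) * K) (l := l)
    (fun k => measurable_gaussianStatistic k) (fun j => (ht j).comp measurable_snd)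
    (fun j z => ht1 j z.2) ?_ ?_ ?_ ?_ hl0 ?_
  · have e : l / 2 * R + 1 / (2 * l) * (d * Real.pi ^ 2 + 2 * (1 / σ ^ 2) * K) =
        R * (2 / σ ^ 2 * K + Real.pi ^ 2 * d) / (2 * d) + d / 2 := by
      have e1 : (d : ℝ) * Real.pi ^ 2 + 2 * (1 / σ ^ 2) * K = l * d := by
        rw [hl]
        field_simp
        ring
      have e2 : 2 / σ ^ 2 * K + Real.pi ^ 2 * d = l * d := by
        rw [hl]
        field_simp
      rw [e1, e2]
      field_simp
    rw [e] at hvt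
    have h3 : (d : ℝ) / 2 ≤ R * (2 / σ ^ 2 * K + Real.pi ^ 2 * d) / (2 * d) := by linarith
    rw [le_div_iff₀ (by positivity)] at h3
    linarith
  · intro u
    simpa using (integrable_productChannelLaw_iff (ν := ν) hσ hq u fun _ => 1).1
      (integrable_const 1)
  · intro u
    have := integral_productChannelLaw_eq (ν := ν) hσ hq u fun _ => 1
    simpa using this.symm
  · intro j u
    simp_rw [← sum_gaussianScore_eq]
    exact (integrable_productChannelLaw_iff hσ hq u _).1
      (memLp_sum_gaussianScore hq hq1 _ j).integrable_sq
  · intro j u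
    simp_rw [← sum_gaussianScore_eq]
    rw [← integral_productChannelLaw_eq (ν := ν) hσ hq u
      fun z => (∑ i, gaussianScore σ (WithLp.toLp 2 u) j (z.1 i)) ^ 2]
    exact integral_sq_sum_gaussianScore_le hσ hq hq1 _ j
  · intro u hu c
    have hθ : (WithLp.toLp 2 u : EuclideanSpace ℝ (Fin d)) ∈ paramCube d := hu
    have hth : ∀ j, MemLp (fun z : (Fin n → EuclideanSpace ℝ (Fin d)) × Y => t j z.2 - u j) 2
        (productChannelLaw (gaussianLocation σ (WithLp.toLp 2 u)) ν q) := fun j =>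
      MemLp.of_bound (((ht j).comp measurable_snd).sub_const _).aestronglyMeasurable (1 + |u j|)
        (Filter.Eventually.of_forall fun z =>
          (abs_sub _ _).trans (add_le_add_left (ht1 j z.2) _))
    have hmain := sum_integral_mul_score_le hq hq1 (measurable_gaussianScore (WithLp.toLp 2 u))
      (memLp_gaussianScore _) (by positivity : 0 < 1 / σ ^ 2) (gaussianScore_subGaussian _ hσ)
      (integral_gaussianScore _) hK0 (hK _ hθ) (h := fun j y => t j y - u j)
      (fun j => (ht j).sub_const _) hth c hl0
    simp_rw [sum_gaussianScore_eq, integral_productChannelLaw_eq hσ hq u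
      fun z => (t _ z.2 - u _) * _] at hmain
    refine hmain.trans ?_
    gcongr
    exact hR _ hθ

end GaussianChannelPairing

-- Truncation of the estimator.

/-- The truncation of a real number to `[-1, 1]`. -/
noncomputable def clampUnit (a : ℝ) : ℝ := max (-1) (min 1 a)

lemma measurable_clampUnit : Measurable clampUnit := by
  unfold clampUnit
  fun_prop

lemma abs_clampUnit_le (a : ℝ) : |clampUnit a| ≤ 1 :=
  abs_le.2 ⟨le_max_left _ _, max_le (by norm_num) (min_le_left _ _)⟩

/-- Truncation is `1`-Lipschitz and fixes the points of `[-1, 1]`, so it moves no estimate away from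
a parameter of the cube. -/
lemma sq_clampUnit_sub_le (a : ℝ) {b : ℝ} (hb : b ∈ Set.Icc (-1 : ℝ) 1) :
    (clampUnit a - b) ^ 2 ≤ (a - b) ^ 2 := by
  have hb' : clampUnit b = b := by
    rw [clampUnit, min_eq_right hb.2, max_eq_right hb.1]
  rw [sq_le_sq]
  conv_lhs => rw [← hb']
  unfold clampUnit
  refine (abs_max_sub_max_le_max _ _ _ _).trans ?_
  rw [sub_self, abs_zero]
  refine max_le (abs_nonneg _) ((abs_min_sub_min_le_max _ _ _ _).trans ?_)
  simp

-- Blackboard protocols as product channels, and the main theorem.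

namespace BlackboardProtocol

variable {T n : ℕ} {𝒳 : Type*} [MeasurableSpace 𝒳]
  {𝒴 : Fin T × Fin n → Type*} [∀ s, MeasurableSpace (𝒴 s)] {ν : ∀ s, Measure (𝒴 s)}

lemma jointLaw_eq_productChannelLaw (C : BlackboardProtocol 𝒳 𝒴 ν) (P : Measure 𝒳) :
    C.jointLaw P = productChannelLaw P (Measure.pi ν) C.nodeDensity := by
  unfold jointLaw productChannelLaw
  simp_rw [transcriptDensity_eq_prod_nodeDensity]
  rfl

lemma lintegral_productLikelihood_nodeDensity [∀ s, SigmaFinite (ν s)]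
    (C : BlackboardProtocol 𝒳 𝒴 ν) (x : Fin n → 𝒳) :
    ∫⁻ π, productLikelihood C.nodeDensity (x, π) ∂(Measure.pi ν) = 1 := by
  rw [← C.lintegral_transcriptDensity x]
  simp_rw [transcriptDensity_eq_prod_nodeDensity]
  rfl

end BlackboardProtocol

theorem corollary3 {d n T : ℕ} {σ : ℝ} (hσ : 0 < σ)
    {𝒴 : Fin T × Fin n → Type*} [∀ s, MeasurableSpace (𝒴 s)]
    (ν : ∀ s, Measure (𝒴 s)) [∀ s, SigmaFinite (ν s)]
    (C : BlackboardProtocol (EuclideanSpace ℝ (Fin d)) 𝒴 ν)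
    (θhat : Transcript 𝒴 → EuclideanSpace ℝ (Fin d)) (hθhat : Measurable θhat) :
    (d : ℝ≥0∞) ^ 2 /
        (ENNReal.ofReal (2 / σ ^ 2) *
            (⨆ θ ∈ paramCube d, C.mutualInfo (gaussianLocation σ θ)) +
          ENNReal.ofReal (Real.pi ^ 2) * (d : ℝ≥0∞))
      ≤ ⨆ θ ∈ paramCube d,
          ∫⁻ π, ENNReal.ofReal (‖θhat π - θ‖ ^ 2) ∂(C.transcriptLaw (gaussianLocation σ θ)) := by
  set I := ⨆ θ ∈ paramCube d, C.mutualInfo (gaussianLocation σ θ) with hI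
  set R := ⨆ θ ∈ paramCube d,
    ∫⁻ π, ENNReal.ofReal (‖θhat π - θ‖ ^ 2) ∂(C.transcriptLaw (gaussianLocation σ θ)) with hRdef
  rcases eq_or_ne d 0 with hd | hd
  · simp [hd]
  -- An infinite information makes the lower bound `0`, and an infinite risk makes the inequality
  -- trivial. Otherwise both suprema are finite and the real-valued bound applies to their `toReal`.
  by_cases hItop : I = ∞
  · have h0 : ENNReal.ofReal (2 / σ ^ 2) ≠ 0 := (ENNReal.ofReal_pos.2 (by positivity)).ne'
    rw [hItop, ENNReal.mul_top h0, top_add, ENNReal.div_top]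
    exact zero_le
  by_cases hRtop : R = ∞
  · rw [hRtop]
    exact le_top
  have hq := C.measurable_nodeDensity
  have hq1 := C.lintegral_productLikelihood_nodeDensity
  have hcoord : ∀ j, Measurable fun π : Transcript 𝒴 => θhat π j := fun j =>
    (by fun_prop : Measurable fun x : EuclideanSpace ℝ (Fin d) => x j).comp hθhat
  have hreal := sq_le_risk_mul_information (K := I.toReal) (R := R.toReal) hσ hd hq hq1
    (t := fun j π => clampUnit (θhat π j)) (fun j => measurable_clampUnit.comp (hcoord j))
    (fun j π => abs_clampUnit_le _) ENNReal.toReal_nonneg ?_ ?_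
  · refine ENNReal.div_le_of_le_mul ?_
    have := ENNReal.ofReal_le_ofReal hreal
    rwa [ENNReal.ofReal_mul ENNReal.toReal_nonneg, ENNReal.ofReal_add (by positivity)
      (by positivity), ENNReal.ofReal_mul (by positivity), ENNReal.ofReal_mul (by positivity),
      ENNReal.ofReal_toReal hItop, ENNReal.ofReal_toReal hRtop, ENNReal.ofReal_natCast,
      ENNReal.ofReal_pow (Nat.cast_nonneg d), ENNReal.ofReal_natCast] at this
  · intro θ hθ
    rw [ENNReal.ofReal_toReal hItop, ← C.jointLaw_eq_productChannelLaw]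
    exact le_iSup₂_of_le θ hθ le_rfl
  · intro θ hθ
    have hprob : IsProbabilityMeasure
        (productChannelLaw (gaussianLocation σ θ) (Measure.pi ν) C.nodeDensity) :=
      isProbabilityMeasure_productChannelLaw hq hq1
    have hm : ∀ j, Measurable fun z : (Fin n → EuclideanSpace ℝ (Fin d)) × Transcript 𝒴 =>
        (clampUnit (θhat z.2 j) - θ j) ^ 2 := fun j =>
      (((measurable_clampUnit.comp (hcoord j)).comp measurable_snd).sub_const _).pow_const 2
    have hi : ∀ j, Integrable (fun z : (Fin n → EuclideanSpace ℝ (Fin d)) × Transcript 𝒴 =>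
        (clampUnit (θhat z.2 j) - θ j) ^ 2)
        (productChannelLaw (gaussianLocation σ θ) (Measure.pi ν) C.nodeDensity) := by
      intro j
      refine Integrable.of_bound (hm j).aestronglyMeasurable ((1 + |θ j|) ^ 2)
        (Filter.Eventually.of_forall fun z => ?_)
      rw [Real.norm_of_nonneg (sq_nonneg _), ← sq_abs]
      gcongr
      exact (abs_sub _ _).trans (add_le_add_left (abs_clampUnit_le _) _)
    rw [← integral_finsetSum _ fun j _ => hi j, integral_eq_lintegral_of_nonneg_ae
      (Filter.Eventually.of_forall fun z => Finset.sum_nonneg fun j _ => sq_nonneg _)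
      (Finset.measurable_fun_sum _ fun j _ => hm j).aestronglyMeasurable]
    -- The truncated risk at `θ` is compared with the original one pointwise in the transcript,
    -- coordinate by coordinate; this uses that `θ` lies in the cube.
    refine ENNReal.toReal_mono hRtop (le_trans ?_ (le_iSup₂_of_le θ hθ le_rfl))
    rw [BlackboardProtocol.transcriptLaw, lintegral_map (by fun_prop) measurable_snd,
      C.jointLaw_eq_productChannelLaw]
    refine lintegral_mono fun z => ENNReal.ofReal_le_ofReal ?_
    rw [EuclideanSpace.real_norm_sq_eq]
    exact Finset.sum_le_sum fun j _ => sq_clampUnit_sub_le _ (hθ j)
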